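/- Let $G$ be a finite directed acyclic graph. Order its vertices by the $G$-order: $a\ge b$ if there is a directed path from $a$ to $b$. An orthogonal pair of independent sets is a pair $(D,U)$ of disjoint sets of vertices, each containing no two adjacent vertices, such that no edge goes from an element of $D$ to an element of $U$. The pair is tight if it does not remain an orthogonal pair of independent sets when some elements of $D$ are removed and replaced by one new element larger than all of them, when some elements of $U$ are removed and replaced by one new element smaller than all of them, or when a new element is added to $D$ or to $U$. Let $\mathrm{top}(G)$ be the set of tight orthogonal pairs. Fix a linear extension $\ell$ and a dual linear extension $\ell'$ of the $G$-order. For a vertex $g$ and $(D,U)\in\mathrm{top}(G)$, the flip $\mathrm{flip}_g(D,U)\in\mathrm{top}(G)$ is defined as follows. If $g\notin D\cup U$, the flip does nothing. Otherwise delete from $D$ all elements less than $g$ and from $U$ all elements greater than $g$, move $g$ from the set containing it to the other one, and then greedily complete $D$ by elements less than $g$, in the order $\ell'$, and $U$ by elements greater than $g$, in the order $\ell$, keeping the pair an orthogonal pair of independent sets. The independence poset is $\mathrm{top}(G)$ with the reflexive and transitive closure of the relations $(D,U)\lessdot \mathrm{flip}_g(D,U)$ for $g\in U$. Each edge of its Hasse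 diagram, from a lower end $(D,U)$ to an upper end $(D',U')$, is labeled by the unique $g\in U$ with $\mathrm{flip}_g(D,U)=(D',U')$; this is a proper edge coloring. For a vertex $g$ of $G$ let $\tau_g$ be the permutation of $\mathrm{top}(G)$ that exchanges the two ends of every edge labeled $g$ and fixes all other elements. The coloring group $\mathfrak{G}(G)$ is the group of permutations of $\mathrm{top}(G)$ generated by all $\tau_g$. **Theorem.** Let $n=|\mathrm{top}(G)|$. 1. If $G$ is connected (as an undirected graph), then $\mathfrak{G}(G)$ contains the alternating group $A_n$ on $\mathrm{top}(G)$. 2. If $G$ is not connected, with connected components $G_1,\dots,G_k$, then $\mathfrak{G}(G)\cong\mathfrak{G}(G_1)\times\dots\times\mathfrak{G}(G_k)$, by an isomorphism that sends, for each $i$ and each vertex $g$ of $G_i$, the generator $\tau_g$ of $\mathfrak{G}(G)$ to the element whose $i$-th coordinate is the generator $\tau_g$ of $\mathfrak{G}(G_i)$ and whose other coordinates are trivial. -/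

import Mathlib

/-! ### Coloring groups of properly edge-colored graphs -/

/-- A proper edge coloring of a simple graph `Γ` with colors in `C`: two edges with a common end
and the same color are equal. (Colors that are not used are harmless: they contribute the identity
to the generators of the coloring group.) -/
structure ProperEdgeColoring {P : Type*} (Γ : SimpleGraph P) (C : Type*) where
  color : Γ.EdgeLabeling C
  proper : ∀ (e f : Γ.edgeSet) (x : P), x ∈ e.1 → x ∈ f.1 → color e = color f → e = f

namespace ProperEdgeColoring

variable {P C : Type*} {Γ : SimpleGraph P} (κ : ProperEdgeColoring Γ C)

/-- There is an edge between `x` and `y`, and it has color `a`. -/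
def HasEdge (a : C) (x y : P) : Prop := ∃ h : Γ.Adj x y, κ.color.get x y h = a

theorem HasEdge.symm {κ : ProperEdgeColoring Γ C} {a : C} {x y : P} (h : κ.HasEdge a x y) :
    κ.HasEdge a y x := by
  obtain ⟨h, rfl⟩ := h
  exact ⟨h.symm, by rw [SimpleGraph.EdgeLabeling.get_comm]⟩

theorem HasEdge.unique {κ : ProperEdgeColoring Γ C} {a : C} {x y z : P} (h : κ.HasEdge a x y)
    (h' : κ.HasEdge a x z) : y = z := by
  obtain ⟨h, rfl⟩ := h
  obtain ⟨h', e⟩ := h'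
  have := κ.proper ⟨s(x, y), h⟩ ⟨s(x, z), h'⟩ x (by simp) (by simp) e.symm
  exact Sym2.congr_right.1 (congrArg Subtype.val this)

open scoped Classical in
/-- The other end of the edge of color `a` at `x`, if there is such an edge, and `x` otherwise. -/
noncomputable def mate (a : C) (x : P) : P :=
  if h : ∃ y, κ.HasEdge a x y then h.choose else x

theorem mate_eq {a : C} {x y : P} (h : κ.HasEdge a x y) : κ.mate a x = y := by
  have hx : ∃ y, κ.HasEdge a x y := ⟨y, h⟩
  rw [mate, dif_pos hx]
  exact hx.choose_spec.unique h

theorem mate_of_not {a : C} {x : P} (h : ¬ ∃ y, κ.HasEdge a x y) : κ.mate a x = x := by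
  rw [mate, dif_neg h]

theorem mate_involutive (a : C) : Function.Involutive (κ.mate a) := by
  intro x
  by_cases h : ∃ y, κ.HasEdge a x y
  · obtain ⟨y, h⟩ := h
    rw [κ.mate_eq h, κ.mate_eq h.symm]
  · rw [κ.mate_of_not h, κ.mate_of_not h]

/-- The permutation `τ a` of the vertices: the product of the (disjoint) transpositions of the two
ends of each edge of color `a`. -/
noncomputable def tau (a : C) : Equiv.Perm P := (κ.mate_involutive a).toPerm

/-- The coloring group: the group of permutations of the vertices generated by all `τ a`. -/
def coloringGroup : Subgroup (Equiv.Perm P) := Subgroup.closure (Set.range κ.tau)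

/-- The generator `τ a`, as an element of the coloring group. -/
noncomputable def gen (a : C) : κ.coloringGroup :=
  ⟨κ.tau a, Subgroup.subset_closure ⟨a, rfl⟩⟩

end ProperEdgeColoring

/-! ### Directed acyclic graphs and tight orthogonal pairs -/

/-- A directed acyclic graph on the vertex type `V`. -/
structure Dag (V : Type*) extends Digraph V where
  acyclic : ∀ v, ¬ Relation.TransGen Adj v v

namespace Dag

variable {V : Type*} (G : Dag V)

/-- The strict `G`-order: `G.Gt a b` means `a > b`, i.e. `a ≠ b` and there is a directed path from
`a` to `b` (as `G` is acyclic, this is the existence of a path of positive length). -/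
def Gt (a b : V) : Prop := Relation.TransGen G.Adj a b

/-- The underlying undirected graph. -/
def undirected : SimpleGraph V := G.toDigraph.toSimpleGraphInclusive

/-- The sub-dag induced on a set of vertices. -/
def induce (s : Set V) : Dag s where
  Adj a b := G.Adj a b
  acyclic v h := G.acyclic v (Relation.TransGen.lift (p := G.Adj) Subtype.val (fun _ _ h => h) _ _ h)

/-- A connected component of `G`, as a directed acyclic graph. -/
abbrev component (c : G.undirected.ConnectedComponent) : Dag c.supp := G.induce c.supp

/-- No two elements of `S` are adjacent. -/
def Independent (S : Finset V) : Prop := ∀ a ∈ S, ∀ b ∈ S, ¬ G.Adj a b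

/-- `(D, U)` is an orthogonal pair of independent sets: `D` and `U` are disjoint, and there is no
edge from an element of `D` to an element of `U`. -/
structure Orthogonal (D U : Finset V) : Prop where
  indepD : G.Independent D
  indepU : G.Independent U
  disj : ∀ v, v ∈ D → v ∉ U
  noEdge : ∀ d ∈ D, ∀ u ∈ U, ¬ G.Adj d u

open scoped Classical in
/-- An orthogonal pair `(D, U)` of independent sets is tight if it does not remain one when some
elements of `D` are increased (removed and replaced by a larger element), or some elements
of `U` are decreased, or a new element is added to `D` or to `U` (this is the case `S = ∅`). -/
structure Tight (D U : Finset V) : Prop where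
  orth : G.Orthogonal D U
  maxD : ∀ S ⊆ D, ∀ v ∉ D, (∀ s ∈ S, G.Gt v s) → ¬ G.Orthogonal (insert v (D \ S)) U
  minU : ∀ S ⊆ U, ∀ v ∉ U, (∀ s ∈ S, G.Gt s v) → ¬ G.Orthogonal D (insert v (U \ S))

/-- A linear extension of the `G`-order: a list of all vertices, in which smaller vertices come
before larger ones. -/
structure LinearExt where
  list : List V
  nodup : list.Nodup
  mem : ∀ v, v ∈ list
  ordered : list.Pairwise fun a b => ¬ G.Gt a b

/-- A dual linear extension of the `G`-order: a list of all vertices, in which larger vertices come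
before smaller ones. -/
structure DualLinearExt where
  list : List V
  nodup : list.Nodup
  mem : ∀ v, v ∈ list
  ordered : list.Pairwise fun a b => ¬ G.Gt b a

variable {G} in
/-- The set `top(G)` of tight orthogonal pairs of `G`. The parameters are the linear extension and
the dual linear extension that are used for the flips. -/
@[ext]
structure Tops (l : G.LinearExt) (l' : G.DualLinearExt) where
  D : Finset V
  U : Finset V
  tight : G.Tight D U

/-! ### Flips -/

open scoped Classical in
/-- Go through the list `l` and insert each element that may be inserted at that moment. -/
noncomputable def greedy (P : V → Finset V → Prop) (l : List V) (S : Finset V) : Finset V :=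
  l.foldl (fun S v => if P v S then insert v S else S) S

open scoped Classical in
/-- Greedy completion of `D` by elements less than `g`, in the order of the list `l'`. -/
noncomputable def completeD (g : V) (l' : List V) (D U : Finset V) : Finset V :=
  greedy (fun v D => G.Gt g v ∧ G.Orthogonal (insert v D) U) l' D

open scoped Classical in
/-- Greedy completion of `U` by elements greater than `g`, in the order of the list `l`. -/
noncomputable def completeU (g : V) (l : List V) (D U : Finset V) : Finset V :=
  greedy (fun v U => G.Gt v g ∧ G.Orthogonal D (insert v U)) l U

open scoped Classical in
/-- What is left of `D` when the elements less than `g` and the element `g` are deleted. -/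
noncomputable def keepD (g : V) (D : Finset V) : Finset V := {d ∈ D | ¬ G.Gt g d ∧ d ≠ g}

open scoped Classical in
/-- What is left of `U` when the elements greater than `g` and the element `g` are deleted. -/
noncomputable def keepU (g : V) (U : Finset V) : Finset V := {u ∈ U | ¬ G.Gt u g ∧ u ≠ g}

open scoped Classical in
/-- The set `D` before the completion: `g` has switched its set. -/
noncomputable def switchD (g : V) (D U : Finset V) : Finset V :=
  if g ∈ U then insert g (G.keepD g D) else G.keepD g D

open scoped Classical in
/-- The set `U` before the completion: `g` has switched its set. -/
noncomputable def switchU (g : V) (D U : Finset V) : Finset V :=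
  if g ∈ D then insert g (G.keepU g U) else G.keepU g U

section Lemmas

variable {G}

theorem gt_trans {a b c : V} (h : G.Gt a b) (h' : G.Gt b c) : G.Gt a c := Relation.TransGen.trans h h'

theorem gt_irrefl (a : V) : ¬ G.Gt a a := G.acyclic a

theorem gt_of_adj {a b : V} (h : G.Adj a b) : G.Gt a b := Relation.TransGen.single h

/-- Tightness, vertex by vertex. -/
theorem tight_iff {D U : Finset V} : G.Tight D U ↔ G.Orthogonal D U ∧
    ∀ v ∉ D, v ∉ U → (∃ d ∈ D, G.Adj d v) ∨ ∃ u ∈ U, G.Adj v u := by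
  classical
  constructor
  · refine fun h => ⟨h.orth, fun v hD hU => ?_⟩
    by_contra! hv
    obtain ⟨h1, h2⟩ := hv
    refine h.maxD {d ∈ D | G.Adj v d} (Finset.filter_subset _ _) v hD
      (fun s hs => gt_of_adj (Finset.mem_filter.1 hs).2) ⟨?_, h.orth.indepU, ?_, ?_⟩
    · intro a ha b hb
      simp only [Finset.mem_insert, Finset.mem_sdiff, Finset.mem_filter, not_and] at ha hb
      rcases ha with rfl | ha <;> rcases hb with rfl | hb
      · exact fun h => gt_irrefl _ (gt_of_adj h)
      · exact hb.2 hb.1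
      · exact h1 _ ha.1
      · exact h.orth.indepD _ ha.1 _ hb.1
    · intro a ha
      simp only [Finset.mem_insert, Finset.mem_sdiff] at ha
      rcases ha with rfl | ha
      · exact hU
      · exact h.orth.disj _ ha.1
    · intro a ha
      simp only [Finset.mem_insert, Finset.mem_sdiff] at ha
      rcases ha with rfl | ha
      · exact h2
      · exact h.orth.noEdge _ ha.1
  · rintro ⟨ho, h⟩
    refine ⟨ho, fun S hS v hv hs hor => ?_, fun S hS v hv hs hor => ?_⟩
    · rcases h v hv (hor.disj v (by simp)) with ⟨d, hd, hdv⟩ | ⟨u, hu, hvu⟩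
      · have : d ∉ S := fun hdS => gt_irrefl _ (gt_trans (hs d hdS) (gt_of_adj hdv))
        exact hor.indepD d (by simp [hd, this]) v (by simp) hdv
      · exact hor.noEdge v (by simp) u hu hvu
    · rcases h v (fun hD => hor.disj v hD (by simp)) hv with ⟨d, hd, hdv⟩ | ⟨u, hu, hvu⟩
      · exact hor.noEdge d hd v (by simp) hdv
      · have : u ∉ S := fun huS => gt_irrefl _ (gt_trans (hs u huS) (gt_of_adj hvu))
        exact hor.indepU v (by simp) u (by simp [hu, this]) hvu

theorem subset_greedy (P : V → Finset V → Prop) (l : List V) (S : Finset V) :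
    S ⊆ greedy P l S := by
  classical
  induction l generalizing S with
  | nil => exact fun _ h => h
  | cons v l ih =>
    refine Finset.Subset.trans ?_ (ih _)
    dsimp only
    split_ifs
    · exact Finset.subset_insert _ _
    · exact fun _ h => h

open scoped Classical in
theorem greedy_induction (P : V → Finset V → Prop) (l : List V) (S : Finset V)
    (I : Finset V → Prop) (h0 : I S) (h1 : ∀ v S, I S → P v S → I (insert v S)) :
    I (greedy P l S) := by
  induction l generalizing S with
  | nil => exact h0
  | cons v l ih =>
    refine ih _ ?_
    dsimp only
    split_ifs with h
    · exact h1 _ _ h0 h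
    · exact h0

theorem greedy_not_mem (P : V → Finset V → Prop) (R : V → V → Prop) (l : List V)
    (hl : l.Pairwise R) (S : Finset V) (v : V) (hv : v ∈ l) (hvS : v ∉ greedy P l S) :
    ∃ S' ⊆ greedy P l S, ¬ P v S' ∧ ∀ x ∈ S', x ∉ S → R x v := by
  classical
  induction l generalizing S with
  | nil => simp at hv
  | cons w l ih =>
    rw [List.pairwise_cons] at hl
    by_cases hvw : v ∈ l
    · obtain ⟨S', h1, h2, h3⟩ := ih hl.2 _ hvw hvS
      refine ⟨S', h1, h2, fun x hx hxS => ?_⟩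
      by_cases hxw : x = w
      · exact hxw ▸ hl.1 v hvw
      · refine h3 x hx ?_
        dsimp only
        split_ifs
        · simp [hxw, hxS]
        · exact hxS
    · have : v = w := by simpa [hvw] using hv
      subst this
      refine ⟨S, subset_greedy _ _ _, fun hP => hvS ?_, fun x h h' => absurd h h'⟩
      refine subset_greedy P l _ ?_
      simp [hP]

theorem mem_keepD {g v : V} {D : Finset V} :
    v ∈ G.keepD g D ↔ v ∈ D ∧ ¬ G.Gt g v ∧ v ≠ g := by
  simp [keepD]

theorem mem_keepU {g v : V} {U : Finset V} :
    v ∈ G.keepU g U ↔ v ∈ U ∧ ¬ G.Gt v g ∧ v ≠ g := by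
  simp [keepU]

theorem mem_switchD {g v : V} {D U : Finset V} :
    v ∈ G.switchD g D U ↔ (v = g ∧ g ∈ U) ∨ v ∈ G.keepD g D := by
  classical
  by_cases h : g ∈ U <;> simp [switchD, h]

theorem mem_switchU {g v : V} {D U : Finset V} :
    v ∈ G.switchU g D U ↔ (v = g ∧ g ∈ D) ∨ v ∈ G.keepU g U := by
  classical
  by_cases h : g ∈ D <;> simp [switchU, h]

theorem orthogonal_switch {g : V} {D U : Finset V} (h : G.Orthogonal D U) :
    G.Orthogonal (G.switchD g D U) (G.switchU g D U) := by
  have irr : ∀ v, ¬ G.Adj v v := fun v h => gt_irrefl v (gt_of_adj h)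
  obtain ⟨h1, h2, h3, h4⟩ := h
  refine ⟨?_, ?_, ?_, ?_⟩
  · intro a ha b hb hab
    rw [mem_switchD, mem_keepD] at ha hb
    rcases ha with ⟨rfl, ha⟩ | ha <;> rcases hb with ⟨rfl, hb⟩ | hb
    · exact irr _ hab
    · exact hb.2.1 (gt_of_adj hab)
    · exact h4 _ ha.1 _ hb hab
    · exact h1 _ ha.1 _ hb.1 hab
  · intro a ha b hb hab
    rw [mem_switchU, mem_keepU] at ha hb
    rcases ha with ⟨rfl, ha⟩ | ha <;> rcases hb with ⟨rfl, hb⟩ | hb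
    · exact irr _ hab
    · exact h4 _ ha _ hb.1 hab
    · exact ha.2.1 (gt_of_adj hab)
    · exact h2 _ ha.1 _ hb.1 hab
  · intro a ha hb
    rw [mem_switchD, mem_keepD] at ha
    rw [mem_switchU, mem_keepU] at hb
    rcases ha with ⟨rfl, ha⟩ | ha <;> rcases hb with ⟨hb1, hb⟩ | hb
    · exact h3 _ hb ha
    · exact hb.2.2 rfl
    · exact ha.2.2 hb1
    · exact h3 _ ha.1 hb.1
  · intro a ha b hb hab
    rw [mem_switchD, mem_keepD] at ha
    rw [mem_switchU, mem_keepU] at hb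
    rcases ha with ⟨rfl, ha⟩ | ha <;> rcases hb with ⟨rfl, hb⟩ | hb
    · exact irr _ hab
    · exact h2 _ ha _ hb.1 hab
    · exact h1 _ ha.1 _ hb hab
    · exact h4 _ ha.1 _ hb.1 hab

/-- The result of the flip, and what is preserved by it. -/
theorem flip_spec (l : G.LinearExt) (l' : G.DualLinearExt) {g : V} {D U : Finset V}
    (h : G.Tight D U) (hg : g ∈ D ∨ g ∈ U) :
    let D' := G.completeD g l'.list (G.switchD g D U) (G.switchU g D U)
    let U' := G.completeU g l.list D' (G.switchU g D U)
    G.Tight D' U' ∧ (∀ v, ¬ G.Gt g v → (v ∈ D' ↔ v ∈ G.switchD g D U)) ∧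
      ∀ v, ¬ G.Gt v g → (v ∈ U' ↔ v ∈ G.switchU g D U) := by
  classical
  intro D' U'
  have ho := orthogonal_switch (g := g) h.orth
  have hD1 : G.switchD g D U ⊆ D' := subset_greedy _ _ _
  have hU1 : G.switchU g D U ⊆ U' := subset_greedy _ _ _
  have hD2 : G.Orthogonal D' (G.switchU g D U) :=
    greedy_induction _ _ _ (fun E => G.Orthogonal E (G.switchU g D U)) ho (fun _ _ _ h => h.2)
  have hU2 : G.Orthogonal D' U' :=
    greedy_induction _ _ _ (fun U => G.Orthogonal D' U) hD2 (fun _ _ _ h => h.2)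
  have hD3 : ∀ v ∈ D', G.Gt g v ∨ v ∈ G.switchD g D U :=
    greedy_induction _ _ _ (fun S => ∀ v ∈ S, G.Gt g v ∨ v ∈ G.switchD g D U)
      (fun v h => Or.inr h) (by
        intro v S hS hP w hw
        rcases Finset.mem_insert.1 hw with rfl | hw
        · exact Or.inl hP.1
        · exact hS w hw)
  have hU3 : ∀ v ∈ U', G.Gt v g ∨ v ∈ G.switchU g D U :=
    greedy_induction _ _ _ (fun S => ∀ v ∈ S, G.Gt v g ∨ v ∈ G.switchU g D U)
      (fun v h => Or.inr h) (by
        intro v S hS hP w hw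
        rcases Finset.mem_insert.1 hw with rfl | hw
        · exact Or.inl hP.1
        · exact hS w hw)
  refine ⟨tight_iff.2 ⟨hU2, fun v hvD hvU => ?_⟩,
    fun v hv => ⟨fun h => (hD3 v h).resolve_left hv, fun h => hD1 h⟩,
    fun v hv => ⟨fun h => (hU3 v h).resolve_left hv, fun h => hU1 h⟩⟩
  by_contra! hcon
  obtain ⟨c1, c2⟩ := hcon
  by_cases hgv : G.Gt g v
  · obtain ⟨S, hS, hP, hR⟩ := greedy_not_mem _ _ l'.list l'.ordered _ v (l'.mem v) hvD
    refine hP ⟨hgv, ?_, ho.indepU, ?_, ?_⟩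
    · intro a ha b hb hab
      rw [Finset.mem_insert] at ha hb
      rcases ha with rfl | ha <;> rcases hb with rfl | hb
      · exact gt_irrefl _ (gt_of_adj hab)
      · by_cases hb' : b ∈ G.switchD g D U
        · rw [mem_switchD, mem_keepD] at hb'
          rcases hb' with ⟨rfl, -⟩ | hb'
          · exact gt_irrefl _ (gt_trans hgv (gt_of_adj hab))
          · exact hb'.2.1 (gt_trans hgv (gt_of_adj hab))
        · exact hR b hb hb' (gt_of_adj hab)
      · exact c1 a (hS ha) hab
      · exact hD2.indepD a (hS ha) b (hS hb) hab
    · intro a ha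
      rcases Finset.mem_insert.1 ha with rfl | ha
      · exact fun h => hvU (hU1 h)
      · exact hD2.disj a (hS ha)
    · intro a ha u hu
      rcases Finset.mem_insert.1 ha with rfl | ha
      · exact c2 u (hU1 hu)
      · exact hD2.noEdge a (hS ha) u hu
  · by_cases hvg : G.Gt v g
    · obtain ⟨S, hS, hP, hR⟩ := greedy_not_mem _ _ l.list l.ordered _ v (l.mem v) hvU
      refine hP ⟨hvg, hU2.indepD, ?_, ?_, ?_⟩
      · intro a ha b hb hab
        rw [Finset.mem_insert] at ha hb
        rcases ha with rfl | ha <;> rcases hb with rfl | hb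
        · exact gt_irrefl _ (gt_of_adj hab)
        · exact c2 b (hS hb) hab
        · by_cases ha' : a ∈ G.switchU g D U
          · rw [mem_switchU, mem_keepU] at ha'
            rcases ha' with ⟨rfl, -⟩ | ha'
            · exact gt_irrefl _ (gt_trans (gt_of_adj hab) hvg)
            · exact ha'.2.1 (gt_trans (gt_of_adj hab) hvg)
          · exact hR a ha ha' (gt_of_adj hab)
        · exact hU2.indepU a (hS ha) b (hS hb) hab
      · intro a ha ha'
        rcases Finset.mem_insert.1 ha' with rfl | ha'
        · exact hvD ha
        · exact hU2.disj a ha (hS ha')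
      · intro a ha u hu
        rcases Finset.mem_insert.1 hu with rfl | hu
        · exact c1 a ha
        · exact hU2.noEdge a ha u (hS hu)
    · have hne : v ≠ g := by
        rintro rfl
        rcases hg with hg | hg
        · exact hvU (hU1 (mem_switchU.2 (Or.inl ⟨rfl, hg⟩)))
        · exact hvD (hD1 (mem_switchD.2 (Or.inl ⟨rfl, hg⟩)))
      have e1 : v ∉ D := fun h => hvD (hD1 (mem_switchD.2 (Or.inr (mem_keepD.2 ⟨h, hgv, hne⟩))))
      have e2 : v ∉ U := fun h => hvU (hU1 (mem_switchU.2 (Or.inr (mem_keepU.2 ⟨h, hvg, hne⟩))))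
      rcases (tight_iff.1 h).2 v e1 e2 with ⟨d, hd, hdv⟩ | ⟨u, hu, hvu⟩
      · refine c1 d (hD1 (mem_switchD.2 (Or.inr (mem_keepD.2 ⟨hd, ?_, ?_⟩)))) hdv
        · exact fun h => hgv (gt_trans h (gt_of_adj hdv))
        · rintro rfl
          exact hgv (gt_of_adj hdv)
      · refine c2 u (hU1 (mem_switchU.2 (Or.inr (mem_keepU.2 ⟨hu, ?_, ?_⟩)))) hvu
        · exact fun h => hvg (gt_trans (gt_of_adj hvu) h)
        · rintro rfl
          exact hvg (gt_of_adj hvu)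

end Lemmas

namespace Tops

variable {G} {l : G.LinearExt} {l' : G.DualLinearExt}

open scoped Classical in
/-- The flip of a tight orthogonal pair at `g`. -/
noncomputable def flip (g : V) (x : Tops l l') : Tops l l' :=
  if hg : g ∈ x.D ∨ g ∈ x.U then
    { D := G.completeD g l'.list (G.switchD g x.D x.U) (G.switchU g x.D x.U)
      U := G.completeU g l.list
        (G.completeD g l'.list (G.switchD g x.D x.U) (G.switchU g x.D x.U)) (G.switchU g x.D x.U)
      tight := (flip_spec l l' x.tight hg).1 }
  else x

theorem mem_flip_D {g : V} {x : Tops l l'} (hg : g ∈ x.D ∨ g ∈ x.U) (v : V) (hv : ¬ G.Gt g v) :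
    v ∈ (x.flip g).D ↔ (v = g ∧ g ∈ x.U) ∨ (v ∈ x.D ∧ v ≠ g) := by
  rw [flip, dif_pos hg]
  refine ((flip_spec l l' x.tight hg).2.1 v hv).trans ?_
  simp [mem_switchD, mem_keepD, hv]

theorem mem_flip_U {g : V} {x : Tops l l'} (hg : g ∈ x.D ∨ g ∈ x.U) (v : V) (hv : ¬ G.Gt v g) :
    v ∈ (x.flip g).U ↔ (v = g ∧ g ∈ x.D) ∨ (v ∈ x.U ∧ v ≠ g) := by
  rw [flip, dif_pos hg]
  refine ((flip_spec l l' x.tight hg).2.2 v hv).trans ?_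
  simp [mem_switchU, mem_keepU, hv]

theorem mem_D_iff (x : Tops l l') (v : V) :
    v ∈ x.D ↔ v ∉ x.U ∧ (∀ d ∈ x.D, ¬ G.Adj d v) ∧ ∀ u ∈ x.U, ¬ G.Adj v u := by
  obtain ⟨ho, h⟩ := tight_iff.1 x.tight
  refine ⟨fun hv => ⟨ho.disj v hv, fun d hd => ho.indepD d hd v hv, ho.noEdge v hv⟩,
    fun ⟨h1, h2, h3⟩ => ?_⟩
  by_contra hv
  rcases h v hv h1 with ⟨d, hd, hdv⟩ | ⟨u, hu, hvu⟩
  · exact h2 d hd hdv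
  · exact h3 u hu hvu

theorem mem_U_iff (x : Tops l l') (v : V) :
    v ∈ x.U ↔ v ∉ x.D ∧ (∀ d ∈ x.D, ¬ G.Adj d v) ∧ ∀ u ∈ x.U, ¬ G.Adj v u := by
  obtain ⟨ho, h⟩ := tight_iff.1 x.tight
  refine ⟨fun hv => ⟨fun h => ho.disj v h hv, fun d hd => ho.noEdge d hd v hv,
    ho.indepU v hv⟩, fun ⟨h1, h2, h3⟩ => ?_⟩
  by_contra hv
  rcases h v h1 hv with ⟨d, hd, hdv⟩ | ⟨u, hu, hvu⟩
  · exact h2 d hd hdv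
  · exact h3 u hu hvu

theorem eq_of_agree [Finite V] {g : V} {x y : Tops l l'}
    (hD : ∀ v, ¬ G.Gt g v → (v ∈ x.D ↔ v ∈ y.D)) (hU : ∀ v, ¬ G.Gt v g → (v ∈ x.U ↔ v ∈ y.U)) :
    x = y := by
  have : IsTrans V G.Gt := ⟨fun _ _ _ => gt_trans⟩
  have : Std.Irrefl G.Gt := ⟨gt_irrefl⟩
  have : IsTrans V (Function.swap G.Gt) := ⟨fun _ _ _ h h' => gt_trans h' h⟩
  have : Std.Irrefl (Function.swap G.Gt) := ⟨gt_irrefl⟩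
  have w1 : WellFounded G.Gt := Finite.wellFounded_of_trans_of_irrefl _
  have w2 : WellFounded (Function.swap G.Gt) := Finite.wellFounded_of_trans_of_irrefl _
  apply Tops.ext
  · ext v
    induction v using w1.induction with
    | _ v ih =>
      by_cases hv : G.Gt g v
      · have hv' : ∀ w, G.Adj v w → ¬ G.Gt w g := fun w h h' =>
          gt_irrefl _ (gt_trans hv (gt_trans (gt_of_adj h) h'))
        have hv'' : ¬ G.Gt v g := fun h => gt_irrefl _ (gt_trans hv h)
        have a1 : (∀ d ∈ x.D, ¬ G.Adj d v) ↔ ∀ d ∈ y.D, ¬ G.Adj d v := by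
          refine forall_congr' fun d => ?_
          by_cases hd : G.Adj d v
          · rw [ih d (gt_of_adj hd)]
          · simp [hd]
        have a2 : (∀ u ∈ x.U, ¬ G.Adj v u) ↔ ∀ u ∈ y.U, ¬ G.Adj v u := by
          refine forall_congr' fun u => ?_
          by_cases hu : G.Adj v u
          · rw [hU u (hv' u hu)]
          · simp [hu]
        rw [mem_D_iff, mem_D_iff y, hU v hv'', a1, a2]
      · exact hD v hv
  · ext v
    induction v using w2.induction with
    | _ v ih =>
      by_cases hv : G.Gt v g
      · have hv' : ∀ w, G.Adj w v → ¬ G.Gt g w := fun w h h' =>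
          gt_irrefl _ (gt_trans hv (gt_trans h' (gt_of_adj h)))
        have hv'' : ¬ G.Gt g v := fun h => gt_irrefl _ (gt_trans hv h)
        have a1 : (∀ d ∈ x.D, ¬ G.Adj d v) ↔ ∀ d ∈ y.D, ¬ G.Adj d v := by
          refine forall_congr' fun d => ?_
          by_cases hd : G.Adj d v
          · rw [hD d (hv' d hd)]
          · simp [hd]
        have a2 : (∀ u ∈ x.U, ¬ G.Adj v u) ↔ ∀ u ∈ y.U, ¬ G.Adj v u := by
          refine forall_congr' fun u => ?_
          by_cases hu : G.Adj v u
          · rw [ih u (gt_of_adj hu)]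
          · simp [hu]
        rw [mem_U_iff, mem_U_iff y, hD v hv'', a1, a2]
      · exact hU v hv

theorem flip_flip [Finite V] (g : V) (x : Tops l l') : (x.flip g).flip g = x := by
  by_cases hg : g ∈ x.D ∨ g ∈ x.U
  · have hdisj := x.tight.orth.disj g
    have h1 : g ∈ (x.flip g).D ↔ g ∈ x.U := by simpa using mem_flip_D hg g (gt_irrefl g)
    have h2 : g ∈ (x.flip g).U ↔ g ∈ x.D := by simpa using mem_flip_U hg g (gt_irrefl g)
    have hg' : g ∈ (x.flip g).D ∨ g ∈ (x.flip g).U := by rw [h1, h2]; exact hg.symm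
    refine eq_of_agree (g := g) (fun v hv => ?_) (fun v hv => ?_)
    · rw [mem_flip_D hg' v hv, h2, mem_flip_D hg v hv]
      by_cases hvg : v = g
      · subst hvg; simp
      · simp [hvg]
    · rw [mem_flip_U hg' v hv, h1, mem_flip_U hg v hv]
      by_cases hvg : v = g
      · subst hvg; simp
      · simp [hvg]
  · have : x.flip g = x := by rw [flip, dif_neg hg]
    rw [this, this]

/-! ### The independence poset -/

/-- The generating relations of the independence poset: `y` is the flip of `x` at some element of
the second component of `x`. -/
def UpFlip (x y : Tops l l') : Prop := ∃ g ∈ x.U, x.flip g = y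

theorem exists_rank (l : G.LinearExt) :
    ∃ r : V → ℕ, Function.Injective r ∧ ∀ a b, G.Gt a b → ¬ r a < r b := by
  classical
  refine ⟨fun v => l.list.idxOf v, fun a b h => (List.idxOf_inj (l.mem a)).1 h,
    fun a b hab hlt => ?_⟩
  have ha := List.idxOf_lt_length_of_mem (l.mem a)
  have hb := List.idxOf_lt_length_of_mem (l.mem b)
  have := List.pairwise_iff_getElem.1 l.ordered _ _ ha hb hlt
  rw [List.getElem_idxOf, List.getElem_idxOf] at this
  exact this hab

theorem transGen_upFlip (r : V → ℕ) (inj : Function.Injective r)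
    (mono : ∀ a b, G.Gt a b → ¬ r a < r b) {x y : Tops l l'} (h : Relation.TransGen UpFlip x y) :
    ∃ g, g ∉ x.D ∧ g ∈ y.D ∧ ∀ v, r g < r v → (v ∈ x.D ↔ v ∈ y.D) := by
  have step : ∀ x y : Tops l l', UpFlip x y → ∃ g, g ∉ x.D ∧ g ∈ y.D ∧
      ∀ v, r g < r v → (v ∈ x.D ↔ v ∈ y.D) := by
    rintro x y ⟨g, hg, rfl⟩
    refine ⟨g, fun h => x.tight.orth.disj g h hg, ?_, fun v hv => ?_⟩
    · exact (mem_flip_D (Or.inr hg) g (gt_irrefl g)).2 (Or.inl ⟨rfl, hg⟩)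
    · have hne : v ≠ g := by rintro rfl; exact lt_irrefl _ hv
      rw [mem_flip_D (Or.inr hg) v (fun h => mono _ _ h hv)]
      simp [hne]
  induction h with
  | single h => exact step _ _ h
  | tail _ h ih =>
    obtain ⟨g, g1, g2, g3⟩ := ih
    obtain ⟨k, k1, k2, k3⟩ := step _ _ h
    rcases lt_trichotomy (r g) (r k) with hlt | heq | hgt
    · refine ⟨k, fun hk => k1 ((g3 k hlt).1 hk), k2, fun v hv => ?_⟩
      rw [g3 v (hlt.trans hv), k3 v hv]
    · exact absurd g2 (inj heq ▸ k1)
    · refine ⟨g, g1, (k3 g hgt).1 g2, fun v hv => ?_⟩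
      rw [g3 v hv, k3 v (hgt.trans hv)]

theorem not_transGen_upFlip (x : Tops l l') : ¬ Relation.TransGen UpFlip x x := fun h => by
  obtain ⟨r, inj, mono⟩ := exists_rank l
  obtain ⟨g, h1, h2, -⟩ := transGen_upFlip r inj mono h
  exact h1 h2

/-- The independence poset: the reflexive and transitive closure of the upward flips. -/
instance : PartialOrder (Tops l l') where
  le := Relation.ReflTransGen UpFlip
  le_refl _ := Relation.ReflTransGen.refl
  le_trans _ _ _ := Relation.ReflTransGen.trans
  le_antisymm x y h h' := by
    rcases Relation.reflTransGen_iff_eq_or_transGen.1 h with h | h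
    · exact h.symm
    · exact absurd (h.trans_left h') (not_transGen_upFlip x)

theorem UpFlip.lt {x y : Tops l l'} (h : UpFlip x y) : x < y := by
  refine lt_of_le_of_ne (Relation.ReflTransGen.single h) ?_
  rintro rfl
  exact not_transGen_upFlip x (Relation.TransGen.single h)

theorem upFlip_of_covBy {x y : Tops l l'} (h : x ⋖ y) : UpFlip x y := by
  have hle : Relation.ReflTransGen UpFlip x y := h.lt.le
  rcases Relation.ReflTransGen.cases_head hle with rfl | ⟨z, hxz, hzy⟩
  · exact absurd h.lt (lt_irrefl _)
  · have hzy' : z ≤ y := hzy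
    rcases hzy'.eq_or_lt with rfl | hlt
    · exact hxz
    · exact absurd hlt (h.2 hxz.lt)

theorem label_unique {x : Tops l l'} {g k : V} (hg : g ∈ x.U) (hk : k ∈ x.U)
    (h : x.flip g = x.flip k) : g = k := by
  have key : ∀ g k : V, g ∈ x.U → k ∈ x.U → x.flip g = x.flip k → G.Gt g k ∨ g = k := by
    intro g k hg hk h
    by_contra! hcon
    have : k ∈ (x.flip g).D := by
      rw [h]
      exact (mem_flip_D (Or.inr hk) k (gt_irrefl k)).2 (Or.inl ⟨rfl, hk⟩)
    rw [mem_flip_D (Or.inr hg) k hcon.1] at this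
    rcases this with h | h
    · exact hcon.2 h.1.symm
    · exact x.tight.orth.disj k h.1 hk
  rcases key g k hg hk h with h1 | h1
  · rcases key k g hk hg h.symm with h2 | h2
    · exact absurd (gt_trans h1 h2) (gt_irrefl g)
    · exact h2.symm
  · exact h1

/-- `g` labels the edge `e` of the Hasse diagram: the upper end of `e` is the flip of its lower
end `x` at the element `g` of the second component of `x`. -/
def IsLabel (g : V) (e : Sym2 (Tops l l')) : Prop :=
  ∃ x y : Tops l l', e = s(x, y) ∧ g ∈ x.U ∧ x.flip g = y

theorem existsUnique_label (e : (SimpleGraph.hasse (Tops l l')).edgeSet) :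
    ∃! g, IsLabel g e.1 := by
  obtain ⟨e, he⟩ := e
  have hex : ∃ x y : Tops l l', e = s(x, y) ∧ UpFlip x y := by
    induction e using Sym2.inductionOn with
    | _ x y =>
      rw [SimpleGraph.mem_edgeSet, SimpleGraph.hasse_adj] at he
      rcases he with h | h
      · exact ⟨x, y, rfl, upFlip_of_covBy h⟩
      · exact ⟨y, x, Sym2.eq_swap, upFlip_of_covBy h⟩
  obtain ⟨x, y, rfl, g, hg, hxy⟩ := hex
  refine ⟨g, ⟨x, y, rfl, hg, hxy⟩, ?_⟩
  rintro k ⟨x', y', he', hk, hxy'⟩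
  rcases Sym2.eq_iff.1 he' with ⟨rfl, rfl⟩ | ⟨rfl, rfl⟩
  · exact label_unique hk hg (hxy'.trans hxy.symm)
  · exact absurd (UpFlip.lt ⟨g, hg, hxy⟩) (lt_asymm (UpFlip.lt ⟨k, hk, hxy'⟩))

theorem IsLabel.flip_eq [Finite V] {g : V} {x y : Tops l l'} (h : IsLabel g s(x, y)) :
    x.flip g = y := by
  obtain ⟨x', y', he, -, hxy⟩ := h
  rcases Sym2.eq_iff.1 he with ⟨rfl, rfl⟩ | ⟨rfl, rfl⟩
  · exact hxy
  · rw [← hxy, flip_flip]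

variable (l l') in
/-- The labeling of the Hasse diagram of the independence poset by flips, as a proper edge
coloring with the vertices of `G` as colors. -/
noncomputable def flipColoring [Finite V] :
    ProperEdgeColoring (SimpleGraph.hasse (Tops l l')) V where
  color e := (existsUnique_label e).choose
  proper e f x hx hx' h := by
    have he := (existsUnique_label e).choose_spec.1
    have hf := (existsUnique_label f).choose_spec.1
    change (existsUnique_label e).choose = (existsUnique_label f).choose at h
    rw [← h] at hf
    generalize (existsUnique_label e).choose = g at he hf
    obtain ⟨y, hy⟩ := hx
    obtain ⟨z, hz⟩ := hx'
    rw [hy] at he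
    rw [hz] at hf
    apply Subtype.ext
    rw [hy, hz, ← he.flip_eq, ← hf.flip_eq]

noncomputable instance : DecidableEq (Tops l l') := Classical.decEq _

instance [Finite V] : Finite (Tops l l') :=
  Finite.of_injective (fun x => (x.D, x.U)) fun x y h => by
    simp only [Prod.mk.injEq] at h
    exact Tops.ext h.1 h.2

noncomputable instance [Finite V] : Fintype (Tops l l') := Fintype.ofFinite _

end Tops

end Dag

/-!
The flips are exactly the cover relations of the independence poset (`Dag.Tops.covBy_flip`), so the
generator `τ g` of the coloring group is the flip at `g` as a permutation of the tight orthogonal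
pairs (`Dag.Tops.tau_eq_flipPerm`). A flip at `g` is determined by its first component off the
elements below `g` and its second component off the elements above `g`
(`Dag.Tops.flip_eq_of_agree`). This characterization makes flips easy to compare between different
dags: it shows at once that flips commute with the reversal of all edges, with the restriction to a
connected component, and with the extension from the dag without a sink.

For a connected dag, induction on the number of vertices shows that the flips generate a primitive
group which contains the alternating group. There is a sink or source `g` whose removal leaves a
connected dag (`Dag.exists_extremal_connected`), and by duality `g` may be taken to be a sink. The
pairs without `g` in the second component correspond to the tight orthogonal pairs of the dag
without `g`. They form a subset `Y` of more than half of all pairs `X`, invariant under the flips at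
the other vertices, which by induction induce on `Y` a primitive group containing the alternating
group. As the flip at `g` moves the complement of `Y` into `Y`, the whole group is transitive, and
it is primitive because `Y` is large. If `Y` has at least five elements, the permutations that fix
the complement of `Y` pointwise form a normal subgroup, and counting and the simplicity of the
alternating group show that it contains all even permutations of `Y`
(`Equiv.Perm.viaEmbedding_mem_of_lift`), in particular a 3-cycle. If `Y` has at most four elements,
the flip at an in-neighbor of `g` is a transposition. Both cases end with a theorem of Jordan on
primitive groups.

For the decomposition into components, tight orthogonal pairs are families of tight orthogonal pairs
of the components (`Dag.Tops.bijective_restrict`), and a flip acts on one member of the family.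
-/

namespace Dag

/-! ### Restriction and duality -/

section Constructions

variable {V : Type*} {G : Dag V}

theorem induce_gt {s : Set V} {a b : s} (h : (G.induce s).Gt a b) : G.Gt a b :=
  Relation.TransGen.lift (p := G.Adj) Subtype.val (fun _ _ h => h) _ _ h

variable (G) in
/-- The dag with all edges reversed. -/
def op : Dag V where
  Adj a b := G.Adj b a
  acyclic v h := G.acyclic v (Relation.transGen_swap.1 h)

theorem op_gt {a b : V} : G.op.Gt a b ↔ G.Gt b a := Relation.transGen_swap

theorem op_undirected : G.op.undirected = G.undirected := by
  ext a b
  simp [undirected, Digraph.toSimpleGraphInclusive, op, or_comm]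

theorem undirected_adj {a b : V} : G.undirected.Adj a b ↔ G.Adj a b ∨ G.Adj b a := by
  simp only [undirected, Digraph.toSimpleGraphInclusive, SimpleGraph.fromRel_adj, ne_eq,
    and_iff_right_iff_imp]
  rintro h rfl
  exact gt_irrefl a (gt_of_adj (or_self_iff.1 h))

/-- A linear extension, as a dual linear extension of the reversed dag. -/
def LinearExt.op (l : G.LinearExt) : G.op.DualLinearExt where
  list := l.list
  nodup := l.nodup
  mem := l.mem
  ordered := l.ordered.imp fun h h' => h (op_gt.1 h')

/-- A dual linear extension, as a linear extension of the reversed dag. -/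
def DualLinearExt.op (l : G.DualLinearExt) : G.op.LinearExt where
  list := l.list
  nodup := l.nodup
  mem := l.mem
  ordered := l.ordered.imp fun h h' => h (op_gt.1 h')

open scoped Classical in
theorem exists_restrict_list (L : List V) (s : Set V) (hn : L.Nodup) (hm : ∀ v, v ∈ L)
    {R : V → V → Prop} (hR : L.Pairwise R) :
    ∃ L' : List s, L'.Nodup ∧ (∀ v, v ∈ L') ∧ L'.Pairwise fun a b : s => R a b := by
  refine ⟨L.filterMap fun v => if h : v ∈ s then some ⟨v, h⟩ else none, ?_, ?_, ?_⟩
  · refine hn.filterMap fun a a' b h h' => ?_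
    simp only [Option.mem_def, Option.dite_none_right_eq_some, Option.some.injEq] at h h'
    obtain ⟨_, rfl⟩ := h
    obtain ⟨_, h⟩ := h'
    exact (congrArg Subtype.val h).symm
  · rintro ⟨v, hv⟩
    exact List.mem_filterMap.2 ⟨v, hm v, by simp [hv]⟩
  · refine hR.filterMap _ fun a a' h b hb b' hb' => ?_
    simp only [Option.dite_none_right_eq_some, Option.some.injEq] at hb hb'
    obtain ⟨_, rfl⟩ := hb
    obtain ⟨_, rfl⟩ := hb'
    exact h

theorem LinearExt.nonempty_induce (l : G.LinearExt) (s : Set V) :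
    Nonempty (G.induce s).LinearExt := by
  obtain ⟨L, h1, h2, h3⟩ := exists_restrict_list l.list s l.nodup l.mem l.ordered
  exact ⟨⟨L, h1, h2, h3.imp fun h h' => h (induce_gt h')⟩⟩

theorem DualLinearExt.nonempty_induce (l : G.DualLinearExt) (s : Set V) :
    Nonempty (G.induce s).DualLinearExt := by
  obtain ⟨L, h1, h2, h3⟩ := exists_restrict_list l.list s l.nodup l.mem l.ordered
  exact ⟨⟨L, h1, h2, h3.imp fun h h' => h (induce_gt h')⟩⟩

theorem Orthogonal.op {D U : Finset V} (h : G.Orthogonal D U) : G.op.Orthogonal U D where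
  indepD a ha b hb := h.indepU b hb a ha
  indepU a ha b hb := h.indepD b hb a ha
  disj v hv hv' := h.disj v hv' hv
  noEdge d hd u hu := h.noEdge u hu d hd

theorem Tight.op {D U : Finset V} (h : G.Tight D U) : G.op.Tight U D := by
  obtain ⟨h1, h2⟩ := tight_iff.1 h
  exact tight_iff.2 ⟨h1.op, fun v hv hv' => (h2 v hv' hv).symm⟩

variable [Finite V]

theorem wellFounded_gt : WellFounded G.Gt :=
  have : IsTrans V G.Gt := ⟨fun _ _ _ => gt_trans⟩
  have : Std.Irrefl G.Gt := ⟨gt_irrefl⟩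
  Finite.wellFounded_of_trans_of_irrefl _

theorem wellFounded_swap_gt : WellFounded (Function.swap G.Gt) :=
  have : IsTrans V (Function.swap G.Gt) := ⟨fun _ _ _ h h' => gt_trans h' h⟩
  have : Std.Irrefl (Function.swap G.Gt) := ⟨gt_irrefl⟩
  Finite.wellFounded_of_trans_of_irrefl _

/-- Every independent set `D` is the first component of a tight orthogonal pair: going up from the
minimal vertices, put a vertex into `U` whenever this is allowed by `D` and the smaller elements
of `U`. -/
theorem exists_tight_of_independent (D : Finset V) (hD : G.Independent D) :
    ∃ U, G.Tight D U := by
  classical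
  have := Fintype.ofFinite V
  -- `U` as a predicate `p`: its value at `v` depends on the out-neighbors of `v`.
  let F : ∀ v, (∀ w, Function.swap G.Gt w v → Prop) → Prop := fun v ih =>
    v ∉ D ∧ (∀ d ∈ D, ¬ G.Adj d v) ∧ ∀ w (h : G.Adj v w), ¬ ih w (gt_of_adj h)
  let p : V → Prop := wellFounded_swap_gt.fix F
  have hp : ∀ v, p v ↔ v ∉ D ∧ (∀ d ∈ D, ¬ G.Adj d v) ∧ ∀ w, G.Adj v w → ¬ p w := fun v => by
    have : p v = F v fun w _ => p w := wellFounded_swap_gt.fix_eq F v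
    rw [this]
  have hU : ∀ v, v ∈ Finset.univ.filter p ↔ p v := by simp
  refine ⟨Finset.univ.filter p, tight_iff.2 ⟨⟨hD, fun a ha b hb hab => ?_, fun v hv hv' => ?_,
    fun d hd u hu => ?_⟩, fun v hv hv' => ?_⟩⟩
  · rw [hU] at ha hb
    exact ((hp a).1 ha).2.2 b hab hb
  · exact ((hp v).1 ((hU v).1 hv')).1 hv
  · exact ((hp u).1 ((hU u).1 hu)).2.1 d hd
  · by_contra! hcon
    exact hv' ((hU v).2 ((hp v).2
      ⟨hv, hcon.1, fun w hw hpw => hcon.2 w ((hU w).2 hpw) hw⟩))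

end Constructions

namespace Tops

variable {V : Type*} {G : Dag V} {l : G.LinearExt} {l' : G.DualLinearExt}

theorem exists_mem_D [Finite V] (l : G.LinearExt) (l' : G.DualLinearExt) (v : V) :
    ∃ x : Tops l l', v ∈ x.D := by
  obtain ⟨U, h⟩ := G.exists_tight_of_independent {v} (by
    intro a ha b hb h
    simp only [Finset.mem_singleton] at ha hb
    subst ha hb
    exact gt_irrefl _ (gt_of_adj h))
  exact ⟨⟨_, U, h⟩, by simp⟩

/-- The tight orthogonal pair `(U, D)` of the reversed dag. -/
def op (x : Tops l l') : Tops l'.op l.op := ⟨x.U, x.D, x.tight.op⟩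

/-- The bijection between the tight orthogonal pairs of a dag and of the reversed dag. -/
def opEquiv (l : G.LinearExt) (l' : G.DualLinearExt) : Tops l l' ≃ Tops l'.op l.op where
  toFun := op
  invFun x := ⟨x.U, x.D, x.tight.op⟩
  left_inv _ := rfl
  right_inv _ := rfl

theorem exists_mem_U [Finite V] (l : G.LinearExt) (l' : G.DualLinearExt) (v : V) :
    ∃ x : Tops l l', v ∈ x.U := by
  obtain ⟨x, hx⟩ := exists_mem_D l'.op l.op v
  obtain ⟨x, rfl⟩ := (opEquiv l l').surjective x
  exact ⟨x, hx⟩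

instance [Finite V] : Nonempty (Tops l l') := by
  obtain ⟨U, h⟩ := G.exists_tight_of_independent ∅ (by intro a ha; simp at ha)
  exact ⟨⟨_, U, h⟩⟩

/-! ### Flips -/

theorem flip_of_not {g : V} {x : Tops l l'} (hg : ¬ (g ∈ x.D ∨ g ∈ x.U)) : x.flip g = x := by
  rw [flip, dif_neg hg]

theorem mem_flip_D_iff (x : Tops l l') {g v : V} (hv : ¬ G.Gt g v) :
    v ∈ (x.flip g).D ↔ (v = g ∧ g ∈ x.U) ∨ (v ∈ x.D ∧ v ≠ g) := by
  by_cases hg : g ∈ x.D ∨ g ∈ x.U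
  · exact mem_flip_D hg v hv
  · rw [flip_of_not hg]
    grind

theorem mem_flip_U_iff (x : Tops l l') {g v : V} (hv : ¬ G.Gt v g) :
    v ∈ (x.flip g).U ↔ (v = g ∧ g ∈ x.D) ∨ (v ∈ x.U ∧ v ≠ g) := by
  by_cases hg : g ∈ x.D ∨ g ∈ x.U
  · exact mem_flip_U hg v hv
  · rw [flip_of_not hg]
    grind

theorem self_mem_flip_D {x : Tops l l'} {g : V} : g ∈ (x.flip g).D ↔ g ∈ x.U := by
  simp [mem_flip_D_iff x (gt_irrefl g)]

theorem self_mem_flip_U {x : Tops l l'} {g : V} : g ∈ (x.flip g).U ↔ g ∈ x.D := by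
  simp [mem_flip_U_iff x (gt_irrefl g)]

/-- The flip at `g` is determined by its first component off the elements below `g`, and by its
second component off the elements above `g`. In particular it does not depend on the order in which
the greedy completion proceeds. -/
theorem flip_eq_of_agree [Finite V] {g : V} {x y : Tops l l'}
    (hD : ∀ v, ¬ G.Gt g v → (v ∈ y.D ↔ (v = g ∧ g ∈ x.U) ∨ (v ∈ x.D ∧ v ≠ g)))
    (hU : ∀ v, ¬ G.Gt v g → (v ∈ y.U ↔ (v = g ∧ g ∈ x.D) ∨ (v ∈ x.U ∧ v ≠ g))) :
    x.flip g = y :=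
  eq_of_agree (g := g) (fun v hv => (mem_flip_D_iff x hv).trans (hD v hv).symm)
    (fun v hv => (mem_flip_U_iff x hv).trans (hU v hv).symm)

theorem op_flip [Finite V] (g : V) (x : Tops l l') : x.op.flip g = (x.flip g).op :=
  flip_eq_of_agree (fun _ hv => mem_flip_U_iff x fun h => hv (op_gt.2 h))
    (fun _ hv => mem_flip_D_iff x fun h => hv (op_gt.2 h))

/-- The flip at `g`, as a permutation. -/
noncomputable def flipPerm [Finite V] (l : G.LinearExt) (l' : G.DualLinearExt) (g : V) :
    Equiv.Perm (Tops l l') :=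
  Function.Involutive.toPerm (flip g) (flip_flip g)

@[simp]
theorem flipPerm_apply [Finite V] (g : V) (x : Tops l l') : flipPerm l l' g x = x.flip g := rfl

theorem op_le_op [Finite V] {x y : Tops l l'} (h : x ≤ y) : y.op ≤ x.op := by
  replace h : Relation.ReflTransGen UpFlip x y := h
  induction h with
  | refl => exact le_rfl
  | tail _ hstep ih =>
    rcases hstep with ⟨g, hg, rfl⟩
    exact le_trans (UpFlip.lt ⟨g, self_mem_flip_D.2 hg, by rw [op_flip, flip_flip]⟩).le ih

/-- If the first components of `x ≤ y` agree on an up-set `A`, then so do those of all `z` between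
`x` and `y`. For the proof, choose a linear extension in which `A` comes last: the last vertex in
which the first components of two comparable pairs differ enters on the way up. -/
theorem agree_of_le_of_le [Finite V] {A : Set V} (hA : ∀ a b, G.Gt a b → b ∈ A → a ∈ A)
    {x y z : Tops l l'} (hxz : x ≤ z) (hzy : z ≤ y) (h : ∀ v ∈ A, v ∈ x.D ↔ v ∈ y.D) :
    ∀ v ∈ A, v ∈ x.D ↔ v ∈ z.D := by
  classical
  rcases Relation.reflTransGen_iff_eq_or_transGen.1 hxz with rfl | hxz
  · exact fun _ _ => Iff.rfl
  rcases Relation.reflTransGen_iff_eq_or_transGen.1 hzy with rfl | hzy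
  · exact h
  obtain ⟨r, inj, mono⟩ := exists_rank l
  obtain ⟨N, hN⟩ := (Set.finite_range r).bddAbove
  have hN : ∀ v, r v ≤ N := fun v => hN ⟨v, rfl⟩
  -- The rank `r`, shifted on `A`, so that all of `A` comes after its complement.
  let r' : V → ℕ := fun v => if v ∈ A then r v + N + 1 else r v
  have inj' : Function.Injective r' := fun v w e => by
    have := hN v
    have := hN w
    apply inj
    simp only [r'] at e
    split_ifs at e <;> omega
  have mono' : ∀ a b, G.Gt a b → ¬ r' a < r' b := fun a b hab => by
    have := hN a
    have := hN b
    have := mono a b hab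
    have := hA a b hab
    simp only [r']
    split_ifs <;> grind
  obtain ⟨a, a1, a2, a3⟩ := transGen_upFlip r' inj' mono' hxz
  obtain ⟨b, b1, b2, b3⟩ := transGen_upFlip r' inj' mono' hzy
  have hr : ∀ v w, v ∈ A → w ∉ A → r' w < r' v := fun v w hv hw => by
    have := hN w
    simp only [r', hv, hw, if_true, if_false]
    omega
  have haA : a ∉ A := fun ha => by
    rcases lt_trichotomy (r' a) (r' b) with hlt | heq | hgt
    · have hb : b ∈ A := by
        by_contra hb
        exact lt_asymm hlt (hr _ _ ha hb)
      exact b1 ((a3 b hlt).1 ((h b hb).2 b2))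
    · exact b1 (inj' heq ▸ a2)
    · exact a1 ((h a ha).2 ((b3 a hgt).1 a2))
  exact fun v hv => a3 v (hr v a hv haA)

/-- A flip is a cover relation. For `z` strictly between `x` and `x.flip g`, the first components of
`x` and `z` agree off the elements below `g`, and the second ones off the elements above `g`, except
possibly at `g`. According to whether `g` is in the first component of `z`, this forces `z` to be
the upper or the lower end. -/
theorem covBy_flip [Finite V] {x : Tops l l'} {g : V} (hg : g ∈ x.U) : x ⋖ x.flip g := by
  refine ⟨UpFlip.lt ⟨g, hg, rfl⟩, fun z hxz hzy => ?_⟩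
  have agreeD : ∀ v, ¬ G.Gt g v → v ≠ g → (v ∈ x.D ↔ v ∈ z.D) := by
    intro v hv hne
    refine agree_of_le_of_le (A := {v | ¬ G.Gt g v ∧ v ≠ g}) ?_ hxz.le hzy.le ?_ v ⟨hv, hne⟩
    · rintro a b hab ⟨h1, h2⟩
      refine ⟨fun h => h1 (gt_trans h hab), ?_⟩
      rintro rfl
      exact h1 hab
    · rintro v ⟨h1, h2⟩
      simp [mem_flip_D_iff x h1, h2]
  have agreeU : ∀ v, ¬ G.Gt v g → v ≠ g → (v ∈ x.U ↔ v ∈ z.U) := by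
    intro v hv hne
    have key := agree_of_le_of_le (A := {v | ¬ G.op.Gt g v ∧ v ≠ g}) ?_ (op_le_op hzy.le)
      (op_le_op hxz.le) ?_ v ⟨fun h => hv (op_gt.1 h), hne⟩
    · exact (by simp [mem_flip_U_iff x hv, hne] : v ∈ x.U ↔ v ∈ (x.flip g).U).trans key
    · rintro a b hab ⟨h1, h2⟩
      refine ⟨fun h => h1 (gt_trans h hab), ?_⟩
      rintro rfl
      exact h1 hab
    · rintro v ⟨h1, h2⟩
      rw [op_gt] at h1
      exact (by simp [mem_flip_U_iff x h1, h2] : v ∈ (x.flip g).U ↔ v ∈ x.U)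
  have irr : ∀ v, ¬ G.Adj v v := fun v h => gt_irrefl v (gt_of_adj h)
  have hdis := z.tight.orth.disj g
  have hxdis : g ∉ x.D := fun h => x.tight.orth.disj g h hg
  by_cases hgD : g ∈ z.D
  · refine hzy.ne (eq_of_agree (g := g) (fun v hv => ?_) fun v hv => ?_)
    · rw [mem_flip_D_iff x hv]
      by_cases hvg : v = g
      · subst hvg; simp [hg, hgD]
      · simp [hvg, agreeD v hv hvg]
    · rw [mem_flip_U_iff x hv]
      by_cases hvg : v = g
      · subst hvg; simp [hxdis, hdis hgD]
      · simp [hvg, agreeU v hv hvg]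
  · have hgU : g ∈ z.U := by
      obtain ⟨-, h1, h2⟩ := (mem_U_iff x g).1 hg
      refine (mem_U_iff z g).2 ⟨hgD, fun d hd hdg => ?_, fun u hu hgu => ?_⟩
      · have hne : d ≠ g := by rintro rfl; exact irr _ hdg
        exact h1 d ((agreeD d (fun h => gt_irrefl _ (gt_trans h (gt_of_adj hdg))) hne).2 hd) hdg
      · have hne : u ≠ g := by rintro rfl; exact irr _ hgu
        exact h2 u ((agreeU u (fun h => gt_irrefl _ (gt_trans h (gt_of_adj hgu))) hne).2 hu) hgu
    refine hxz.ne (eq_of_agree (g := g) (fun v hv => ?_) fun v hv => ?_)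
    · by_cases hvg : v = g
      · subst hvg; simp [hxdis, hgD]
      · exact agreeD v hv hvg
    · by_cases hvg : v = g
      · subst hvg; simp [hg, hgU]
      · exact agreeU v hv hvg

theorem hasEdge_flip [Finite V] {x : Tops l l'} {g : V} (hg : g ∈ x.U) :
    (flipColoring l l').HasEdge g x (x.flip g) := by
  have hadj : (SimpleGraph.hasse (Tops l l')).Adj x (x.flip g) :=
    SimpleGraph.hasse_adj.2 (Or.inl (covBy_flip hg))
  refine ⟨hadj, ?_⟩
  have h := existsUnique_label (⟨s(x, x.flip g), hadj⟩ : (SimpleGraph.hasse (Tops l l')).edgeSet)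
  exact h.unique h.choose_spec.1 ⟨x, x.flip g, rfl, hg, rfl⟩

theorem tau_eq_flipPerm [Finite V] (g : V) : (flipColoring l l').tau g = flipPerm l l' g := by
  ext1 x
  change (flipColoring l l').mate g x = x.flip g
  by_cases hU : g ∈ x.U
  · exact ProperEdgeColoring.mate_eq _ (hasEdge_flip hU)
  by_cases hD : g ∈ x.D
  · have := hasEdge_flip (x := x.flip g) (self_mem_flip_U.2 hD)
    rw [flip_flip] at this
    exact ProperEdgeColoring.mate_eq _ this.symm
  · have hx : x.flip g = x := flip_of_not (by simp [hU, hD])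
    rw [hx]
    refine ProperEdgeColoring.mate_of_not _ ?_
    rintro ⟨y, hadj, hc⟩
    have h := (existsUnique_label
      (⟨s(x, y), hadj⟩ : (SimpleGraph.hasse (Tops l l')).edgeSet)).choose_spec.1
    change IsLabel ((flipColoring l l').color.get x y hadj) s(x, y) at h
    rw [hc] at h
    exact hadj.ne (hx.symm.trans h.flip_eq)

theorem coloringGroup_eq [Finite V] :
    (flipColoring l l').coloringGroup = Subgroup.closure (Set.range (flipPerm l l')) := by
  rw [ProperEdgeColoring.coloringGroup]
  congr 2
  ext1 g
  exact tau_eq_flipPerm g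

end Tops

end Dag

/-! ### Permutation groups generated from an invariant subset -/

namespace Equiv.Perm

open MulAction Nat

variable {X Y : Type*}

/-- A group of permutations of `X` that contains lifts of all permutations of a primitive group on
a subset `Y` of more than half of the points is primitive as soon as it is transitive. -/
theorem isPreprimitive_of_lift [Finite X] {f : Y → X} (hf : Function.Injective f)
    {K : Subgroup (Perm Y)} {H : Subgroup (Perm X)}
    (lift : ∀ σ ∈ K, ∃ k ∈ H, ∀ y, k (f y) = f (σ y)) (hcard : Nat.card X < 2 * Nat.card Y)
    (hH : IsPretransitive H X) (hK : IsPreprimitive K Y) : IsPreprimitive H X := by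
  choose k hkH hk using lift
  let F : Y →ₑ[fun σ : K => (⟨k σ.1 σ.2, hkH σ.1 σ.2⟩ : H)] X :=
    ⟨f, fun σ y => (hk σ.1 σ.2 y).symm⟩
  refine IsPreprimitive.of_card_lt (f := F) ?_
  have : (Set.range F).ncard = Nat.card Y := Set.ncard_range_of_injective hf
  rwa [this]

theorem lift_of_closure {ι : Type*} {f : Y → X} {F : ι → Perm Y} {H : Subgroup (Perm X)}
    (lift : ∀ i, ∃ k ∈ H, ∀ y, k (f y) = f (F i y)) :
    ∀ σ ∈ Subgroup.closure (Set.range F), ∃ k ∈ H, ∀ y, k (f y) = f (σ y) := by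
  intro σ hσ
  induction hσ using Subgroup.closure_induction with
  | mem σ hσ =>
    obtain ⟨i, rfl⟩ := hσ
    exact lift i
  | one => exact ⟨1, one_mem _, fun _ => rfl⟩
  | mul σ τ _ _ hσ hτ =>
    obtain ⟨k, hk, hk'⟩ := hσ
    obtain ⟨m, hm, hm'⟩ := hτ
    exact ⟨k * m, mul_mem hk hm, fun y => by simp [hm', hk']⟩
  | inv σ _ hσ =>
    obtain ⟨k, hk, hk'⟩ := hσ
    exact ⟨k⁻¹, inv_mem hk, fun y => by rw [inv_eq_iff_eq, hk']; simp⟩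

variable [Fintype X] [DecidableEq X] [Fintype Y] [DecidableEq Y]

/-- If a group of permutations of `X` contains lifts of all even permutations of a subset `Y` of at
least five and more than half of the points, then it contains those even permutations of `Y`
themselves. They form a normal subgroup of the alternating group of `Y`, which is simple, and this
subgroup is nontrivial because there are more even permutations of `Y` than permutations of the
complement. -/
theorem viaEmbedding_mem_of_lift (f : Y ↪ X) {H : Subgroup (Perm X)}
    (lift : ∀ σ ∈ alternatingGroup Y, ∃ k ∈ H, ∀ y, k (f y) = f (σ y))
    (h5 : 5 ≤ Nat.card Y) (hcard : Nat.card X < 2 * Nat.card Y) :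
    ∀ σ ∈ alternatingGroup Y, viaEmbedding σ f ∈ H := by
  choose k hkH hk using lift
  have hinv : ∀ σ hσ x, x ∈ Set.range f ↔ k σ hσ x ∈ Set.range f := by
    intro σ hσ x
    constructor
    · rintro ⟨y, rfl⟩
      exact ⟨σ y, (hk σ hσ y).symm⟩
    · rintro ⟨y, hy⟩
      refine ⟨σ⁻¹ y, (k σ hσ).injective ?_⟩
      simp [hk, hy]
  let r : alternatingGroup Y → Perm {x // x ∉ Set.range f} := fun σ =>
    (k σ.1 σ.2).subtypePerm fun x => not_congr (hinv σ.1 σ.2 x).symm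
  have hX : Nat.card {x // x ∉ Set.range f} + Nat.card Y = Nat.card X := by
    have h1 : (Set.range f).ncard = Nat.card Y := Set.ncard_range_of_injective f.injective
    have h2 := Set.ncard_add_ncard_compl (Set.range f)
    have h3 : (Set.range f)ᶜ.ncard = Nat.card {x // x ∉ Set.range f} := rfl
    omega
  have : Nontrivial Y := Finite.one_lt_card_iff_nontrivial.1 (by omega)
  have hlt : Nat.card (Perm {x // x ∉ Set.range f}) < Nat.card (alternatingGroup Y) := by
    have h1 := two_mul_nat_card_alternatingGroup (α := Y)
    rw [Nat.card_perm] at h1 ⊢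
    obtain ⟨m, hm⟩ : ∃ m, Nat.card Y = m + 1 := ⟨Nat.card Y - 1, by omega⟩
    have h2 : (Nat.card {x // x ∉ Set.range f})! ≤ m ! := Nat.factorial_le (by omega)
    rw [hm, Nat.factorial_succ] at h1
    have h3 := Nat.factorial_pos m
    have h4 : 5 * m ! ≤ (m + 1) * m ! := Nat.mul_le_mul_right _ (by omega)
    omega
  -- Two lifts that agree on the complement of `Y` differ by an even permutation of `Y` alone.
  obtain ⟨σ, τ, hne, hr⟩ : ∃ σ τ, σ ≠ τ ∧ r σ = r τ := by
    by_contra! hcon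
    exact absurd (Nat.card_le_card_of_injective r fun σ τ h => by
      by_contra hne
      exact hcon σ τ hne h) (by omega)
  let N : Subgroup (alternatingGroup Y) :=
    (H.comap (viaEmbeddingHom f)).comap (alternatingGroup Y).subtype
  have hN : ∀ σ : alternatingGroup Y, σ ∈ N ↔ viaEmbedding σ.1 f ∈ H := fun _ => Iff.rfl
  -- Conjugation by an even permutation of `Y` is conjugation by its lift in `H`.
  have hnorm : N.Normal := ⟨fun n hn g => by
    rw [hN] at hn ⊢
    have : viaEmbedding (g * n * g⁻¹ : alternatingGroup Y).1 f =
        k g.1 g.2 * viaEmbedding n.1 f * (k g.1 g.2)⁻¹ := by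
      rw [eq_mul_inv_iff_mul_eq]
      ext x
      by_cases hx : x ∈ Set.range f
      · obtain ⟨y, rfl⟩ := hx
        simp [hk, viaEmbedding_apply]
      · rw [mul_apply, mul_apply, viaEmbedding_apply_of_notMem _ _ _ hx,
          viaEmbedding_apply_of_notMem _ _ _ fun h => hx ((hinv g.1 g.2 x).2 h)]
    rw [this]
    exact mul_mem (mul_mem (hkH _ _) hn) (inv_mem (hkH _ _))⟩
  have hbot : N ≠ ⊥ := fun hbot => by
    have hmem : τ⁻¹ * σ ∈ N := by
      rw [hN]
      have : viaEmbedding (τ⁻¹ * σ : alternatingGroup Y).1 f =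
          (k τ.1 τ.2)⁻¹ * k σ.1 σ.2 := by
        rw [eq_inv_mul_iff_mul_eq]
        ext x
        by_cases hx : x ∈ Set.range f
        · obtain ⟨y, rfl⟩ := hx
          simp [hk, viaEmbedding_apply]
        · rw [mul_apply, viaEmbedding_apply_of_notMem _ _ _ hx]
          exact (congrArg Subtype.val (DFunLike.congr_fun hr ⟨x, hx⟩)).symm
      rw [this]
      exact mul_mem (inv_mem (hkH _ _)) (hkH _ _)
    rw [hbot, Subgroup.mem_bot, inv_mul_eq_one] at hmem
    exact hne hmem.symm
  have htop : N = ⊤ := (alternatingGroup.normal_subgroup_eq_bot_or_eq_top h5).resolve_left hbot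
  intro σ hσ
  exact (hN ⟨σ, hσ⟩).1 (htop ▸ Subgroup.mem_top _)

theorem alternatingGroup_le_of_lift (f : Y ↪ X) {H : Subgroup (Perm X)}
    (lift : ∀ σ ∈ alternatingGroup Y, ∃ k ∈ H, ∀ y, k (f y) = f (σ y))
    (h5 : 5 ≤ Nat.card Y) (hcard : Nat.card X < 2 * Nat.card Y) (hH : IsPreprimitive H X) :
    alternatingGroup X ≤ H := by
  have h3 : 2 < Fintype.card Y := by
    rw [← Nat.card_eq_fintype_card]
    omega
  obtain ⟨a, b, c, hab, hac, hbc⟩ := Fintype.two_lt_card_iff.1 h3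
  have hcyc := isThreeCycle_swap_mul_swap_same hab hac hbc
  refine alternatingGroup_le_of_isPreprimitive_of_isThreeCycle_mem hH ?_
    (viaEmbedding_mem_of_lift f lift h5 hcard _ hcyc.mem_alternatingGroup)
  rw [IsThreeCycle, viaEmbedding, ← hcyc]
  convert cycleType_extendDomain _

omit [DecidableEq X] in
/-- A primitive permutation group that contains a nontrivial involution with at most three moved
points is the full symmetric group. -/
theorem eq_top_of_involutive_mem {H : Subgroup (Perm X)} (hH : IsPreprimitive H X) {σ : Perm X}
    (hσ : σ ∈ H) (hinv : Function.Involutive σ) (hne : σ ≠ 1)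
    (h3 : Set.ncard {x | σ x ≠ x} ≤ 3) : H = ⊤ := by
  classical
  refine subgroup_eq_top_of_isPreprimitive_of_isSwap_mem hH σ ?_ hσ
  have h2 : σ ^ 2 = 1 := by
    ext x
    simp [sq, hinv x]
  have hcard : {x | σ x ≠ x}.ncard = σ.support.card := by
    rw [← Set.ncard_coe_finset]
    congr
    ext x
    simp
  rw [hcard] at h3
  rw [← card_support_eq_two]
  have h4 := two_dvd_card_support h2
  have h5 : σ.support.card ≠ 0 := by simpa using hne
  omega

end Equiv.Perm

namespace Dag

/-! ### Extremal vertices that are not cut vertices -/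

section Extremal

variable {V : Type*} {G : Dag V}

theorem induce_undirected (s : Set V) : (G.induce s).undirected = G.undirected.induce s := by
  ext a b
  rw [SimpleGraph.comap_adj, undirected_adj]
  exact (undirected_adj (G := G)).symm

theorem exists_sink_source [Finite V] {s : Set V} (hs : s.Nonempty) :
    (∃ a ∈ s, ∀ v ∈ s, ¬ G.Adj a v) ∧ ∃ a ∈ s, ∀ v ∈ s, ¬ G.Adj v a := by
  obtain ⟨a, ha, ha'⟩ := wellFounded_swap_gt (G := G).has_min s hs
  obtain ⟨b, hb, hb'⟩ := wellFounded_gt (G := G).has_min s hs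
  exact ⟨⟨a, ha, fun v hv h => ha' v hv (gt_of_adj h)⟩,
    ⟨b, hb, fun v hv h => hb' v hv (gt_of_adj h)⟩⟩

/-- A connected dag with at least two vertices has a sink or source whose removal leaves a connected
dag: among the sinks and sources take one, `g`, as far as possible from some fixed vertex `r`. If
the removal of `g` separated some vertices from `r`, these would contain a sink or source of `G`,
and the paths from `r` to it would run through `g`. -/
theorem exists_extremal_connected [Finite V] [Nontrivial V] (hG : G.undirected.Connected) :
    ∃ g, ((∀ v, ¬ G.Adj g v) ∨ ∀ v, ¬ G.Adj v g) ∧ (G.induce {g}ᶜ).undirected.Connected := by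
  obtain ⟨r⟩ := hG.nonempty
  have hex : ∃ g, g ≠ r ∧ ((∀ v, ¬ G.Adj g v) ∨ ∀ v, ¬ G.Adj v g) := by
    obtain ⟨⟨a, -, ha⟩, ⟨b, -, hb⟩⟩ := exists_sink_source (G := G) (Set.univ_nonempty (α := V))
    by_contra! hcon
    have har : a = r := by
      by_contra h
      obtain ⟨v, hv⟩ := (hcon a h).1
      exact ha v trivial hv
    have hbr : b = r := by
      by_contra h
      obtain ⟨v, hv⟩ := (hcon b h).2
      exact hb v trivial hv
    subst har hbr
    obtain ⟨v, hv⟩ := hG.preconnected.exists_adj_of_nontrivial b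
    rcases undirected_adj.1 hv with h | h
    · exact ha v trivial h
    · exact hb v trivial h
  obtain ⟨g, ⟨hgr, hg⟩, hmax⟩ := Set.exists_max_image
    {g | g ≠ r ∧ ((∀ v, ¬ G.Adj g v) ∨ ∀ v, ¬ G.Adj v g)} (G.undirected.dist r) (Set.toFinite _) hex
  refine ⟨g, hg, ?_⟩
  rw [induce_undirected]
  let r' : ({g}ᶜ : Set V) := ⟨r, fun h => hgr h.symm⟩
  let K : Set V := {v | ∃ h : v ≠ g, ¬ (G.undirected.induce {g}ᶜ).Reachable r' ⟨v, h⟩}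
  have hK : ∀ v ∈ K, ∀ w, w ≠ g → G.undirected.Adj v w → w ∈ K := by
    rintro v ⟨hv, hv'⟩ w hw hvw
    refine ⟨hw, fun h => hv' (h.trans (SimpleGraph.Adj.reachable ?_))⟩
    exact hvw.symm
  rcases K.eq_empty_or_nonempty with hKe | hKne
  · have hr : ∀ v, (G.undirected.induce {g}ᶜ).Reachable r' v := fun v => by
      by_contra h
      have : v.1 ∈ K := ⟨v.2, h⟩
      simp [hKe] at this
    have : Nonempty ({g}ᶜ : Set V) := ⟨r'⟩
    exact ⟨fun v w => (hr v).symm.trans (hr w)⟩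
  exfalso
  have key : ∃ t ∈ K, (∀ v, ¬ G.Adj t v) ∨ ∀ v, ¬ G.Adj v t := by
    obtain ⟨⟨a, ha, ha'⟩, ⟨b, hb, hb'⟩⟩ := exists_sink_source (G := G) hKne
    rcases hg with hg | hg
    · refine ⟨b, hb, Or.inr fun v hv => ?_⟩
      have hne : v ≠ g := by rintro rfl; exact hg _ hv
      exact hb' v (hK b hb v hne (undirected_adj.2 (Or.inr hv))) hv
    · refine ⟨a, ha, Or.inl fun v hv => ?_⟩
      have hne : v ≠ g := by rintro rfl; exact hg _ hv
      exact ha' v (hK a ha v hne (undirected_adj.2 (Or.inl hv))) hv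
  obtain ⟨t, ⟨htg, ht⟩, hext⟩ := key
  have htr : t ≠ r := by
    rintro rfl
    exact ht (SimpleGraph.Reachable.refl _)
  obtain ⟨p, hp⟩ := hG.exists_walk_length_eq_dist r t
  classical
  by_cases hgp : g ∈ p.support
  · have h1 := hmax t ⟨htr, hext⟩
    have h2 := SimpleGraph.dist_le (p.takeUntil g hgp)
    have h3 := p.length_takeUntil_lt_length hgp htg.symm
    omega
  · exact ht (p.induce {g}ᶜ fun v hv hvg => hgp (hvg ▸ hv)).reachable

end Extremal
end Dag

namespace Dag

namespace Tops

/-! ### Removal of a sink -/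

section Flips

variable {V : Type*} [Finite V] {G : Dag V} {l : G.LinearExt} {l' : G.DualLinearExt}

/-- A vertex that is not isolated can be kept out of both components, by putting a neighbor into the
first or the second one, according to the direction of the edge. -/
theorem exists_notMem {g h : V} (hgh : G.undirected.Adj g h) :
    ∃ x : Tops l l', g ∉ x.D ∧ g ∉ x.U := by
  rcases undirected_adj.1 hgh with hgh | hgh
  · obtain ⟨x, hx⟩ := exists_mem_U l l' h
    exact ⟨x, fun hg => x.tight.orth.noEdge g hg h hx hgh,
      fun hg => x.tight.orth.indepU g hg h hx hgh⟩
  · obtain ⟨x, hx⟩ := exists_mem_D l l' h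
    exact ⟨x, fun hg => x.tight.orth.indepD h hx g hg hgh,
      fun hg => x.tight.orth.noEdge h hx g hg hgh⟩

theorem flipPerm_ne_one (g : V) : flipPerm l l' g ≠ 1 := fun h => by
  obtain ⟨x, hx⟩ := exists_mem_D l l' g
  have : x.flip g = x := DFunLike.congr_fun h x
  exact x.tight.orth.disj g hx (this ▸ self_mem_flip_U.2 hx)

/-- A tight orthogonal pair of a dag with a single vertex `v` is determined by the set that
contains `v`. -/
theorem eq_of_mem_D_iff [Subsingleton V] {v : V} {x y : Tops l l'} (h : v ∈ x.D ↔ v ∈ y.D) :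
    x = y := by
  refine eq_of_agree (g := v) (fun w _ => Subsingleton.elim v w ▸ h) fun w _ => ?_
  obtain rfl := Subsingleton.elim v w
  have irr : ∀ a b, ¬ G.Adj a b := fun a b hab =>
    gt_irrefl a (gt_of_adj (Subsingleton.elim b a ▸ hab))
  rw [mem_U_iff, mem_U_iff y]
  simp [irr, h]

theorem card_le_two [Subsingleton V] [Nonempty V] : Nat.card (Tops l l') ≤ 2 := by
  obtain ⟨v⟩ := ‹Nonempty V›
  have := Nat.card_le_card_of_injective (fun x : Tops l l' => v ∈ x.D)
    fun x y h => eq_of_mem_D_iff (v := v) (by simpa using h)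
  simpa using this

end Flips

section Sink

variable {V : Type*} {G : Dag V} {l : G.LinearExt} {l' : G.DualLinearExt} {g : V}
  {m : (G.induce {g}ᶜ).LinearExt} {m' : (G.induce {g}ᶜ).DualLinearExt}

/-- The tight orthogonal pair `x` of `G` extends the tight orthogonal pair `y` of the dag without
the sink `g`, in such a way that `g` is not in its second component. -/
structure Extends (x : Tops l l') (y : Tops m m') : Prop where
  notMem : g ∉ x.U
  mem_D : ∀ v : ({g}ᶜ : Set V), v.1 ∈ x.D ↔ v ∈ y.D
  mem_U : ∀ v : ({g}ᶜ : Set V), v.1 ∈ x.U ↔ v ∈ y.U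

variable (l l') in
/-- The vertex `g` is put into the first component whenever that component contains no in-neighbor
of `g`. -/
theorem exists_extends [Finite V] (hg : ∀ v, ¬ G.Adj g v) (y : Tops m m') :
    ∃ x : Tops l l', Extends x y := by
  classical
  have := Fintype.ofFinite V
  let D : Finset V :=
    {v | (∃ h : v ≠ g, ⟨v, h⟩ ∈ y.D) ∨ v = g ∧ ∀ d ∈ y.D, ¬ G.Adj d.1 g}
  let U : Finset V := {v | ∃ h : v ≠ g, ⟨v, h⟩ ∈ y.U}
  have hD : ∀ v, v ∈ D ↔ (∃ h : v ≠ g, ⟨v, h⟩ ∈ y.D) ∨ v = g ∧ ∀ d ∈ y.D, ¬ G.Adj d.1 g := by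
    simp [D]
  have hU : ∀ v, v ∈ U ↔ ∃ h : v ≠ g, ⟨v, h⟩ ∈ y.U := by simp [U]
  obtain ⟨ho, ht⟩ := tight_iff.1 y.tight
  refine ⟨⟨D, U, tight_iff.2 ⟨⟨fun a ha b hb hab => ?_, fun a ha b hb hab => ?_, fun v hv hv' => ?_,
    fun d hd u hu hdu => ?_⟩, fun v hv hv' => ?_⟩⟩, ?_, fun v => ?_, fun v => ?_⟩
  · rw [hD] at ha hb
    rcases ha with ⟨hag, ha⟩ | ⟨rfl, -⟩
    · rcases hb with ⟨hbg, hb⟩ | ⟨rfl, hb⟩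
      · exact ho.indepD _ ha _ hb hab
      · exact hb _ ha hab
    · exact hg b hab
  · rw [hU] at ha hb
    obtain ⟨hag, ha⟩ := ha
    obtain ⟨hbg, hb⟩ := hb
    exact ho.indepU _ ha _ hb hab
  · rw [hU] at hv'
    rw [hD] at hv
    obtain ⟨hvg, hv'⟩ := hv'
    rcases hv with ⟨_, hv⟩ | ⟨rfl, -⟩
    · exact ho.disj _ hv hv'
    · exact hvg rfl
  · rw [hU] at hu
    rw [hD] at hd
    obtain ⟨hug, hu⟩ := hu
    rcases hd with ⟨_, hd⟩ | ⟨rfl, -⟩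
    · exact ho.noEdge _ hd _ hu hdu
    · exact hg u hdu
  · by_cases hvg : v = g
    · subst hvg
      rw [hD] at hv
      push Not at hv
      obtain ⟨d, hd, hdv⟩ := hv.2 rfl
      exact Or.inl ⟨d, (hD d).2 (Or.inl ⟨d.2, hd⟩), hdv⟩
    · rcases ht ⟨v, hvg⟩ (fun h => hv ((hD v).2 (Or.inl ⟨hvg, h⟩)))
        (fun h => hv' ((hU v).2 ⟨hvg, h⟩)) with ⟨d, hd, hdv⟩ | ⟨u, hu, hvu⟩
      · exact Or.inl ⟨d, (hD d).2 (Or.inl ⟨d.2, hd⟩), hdv⟩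
      · exact Or.inr ⟨u, (hU u).2 ⟨u.2, hu⟩, hvu⟩
  · exact fun h => ((hU g).1 h).1 rfl
  · have hvg : v.1 ≠ g := v.2
    simp [hD, hvg]
  · have hvg : v.1 ≠ g := v.2
    simp [hU, hvg]

variable (m m') in
theorem exists_extended (hg : ∀ v, ¬ G.Adj g v) {x : Tops l l'} (hx : g ∉ x.U) :
    ∃ y : Tops m m', Extends x y := by
  classical
  have hD : ∀ v : ({g}ᶜ : Set V), v ∈ x.D.subtype (· ∈ ({g}ᶜ : Set V)) ↔ v.1 ∈ x.D := by simp
  have hU : ∀ v : ({g}ᶜ : Set V), v ∈ x.U.subtype (· ∈ ({g}ᶜ : Set V)) ↔ v.1 ∈ x.U := by simp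
  obtain ⟨ho, ht⟩ := tight_iff.1 x.tight
  refine ⟨⟨x.D.subtype (· ∈ ({g}ᶜ : Set V)), x.U.subtype (· ∈ ({g}ᶜ : Set V)),
    tight_iff.2 ⟨⟨fun a ha b hb => ?_, fun a ha b hb => ?_, fun v hv hv' => ?_,
      fun d hd u hu => ?_⟩, fun v hv hv' => ?_⟩⟩, hx, fun v => (hD v).symm, fun v => (hU v).symm⟩
  · exact ho.indepD _ ((hD a).1 ha) _ ((hD b).1 hb)
  · exact ho.indepU _ ((hU a).1 ha) _ ((hU b).1 hb)
  · exact ho.disj _ ((hD v).1 hv) ((hU v).1 hv')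
  · exact ho.noEdge _ ((hD d).1 hd) _ ((hU u).1 hu)
  · rw [hD] at hv
    rw [hU] at hv'
    rcases ht v hv hv' with ⟨d, hd, hdv⟩ | ⟨u, hu, hvu⟩
    · have hne : d ≠ g := by rintro rfl; exact hg _ hdv
      exact Or.inl ⟨⟨d, hne⟩, (hD _).2 hd, hdv⟩
    · have hne : u ≠ g := by rintro rfl; exact hx hu
      exact Or.inr ⟨⟨u, hne⟩, (hU _).2 hu, hvu⟩

theorem Extends.unique {x : Tops l l'} {y z : Tops m m'} (hy : Extends x y) (hz : Extends x z) :
    y = z :=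
  Tops.ext (Finset.ext fun v => (hy.mem_D v).symm.trans (hz.mem_D v))
    (Finset.ext fun v => (hy.mem_U v).symm.trans (hz.mem_U v))

theorem Extends.self_mem_D_iff (hg : ∀ v, ¬ G.Adj g v) {x : Tops l l'} {y : Tops m m'}
    (h : Extends x y) : g ∈ x.D ↔ ∀ d : ({g}ᶜ : Set V), d ∈ y.D → ¬ G.Adj d g := by
  rw [mem_D_iff]
  constructor
  · exact fun hd d hdy => hd.2.1 d ((h.mem_D d).2 hdy)
  · refine fun hd => ⟨h.notMem, fun d hdx hdg => ?_, fun u _ => hg u⟩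
    have hne : d ≠ g := by rintro rfl; exact hg _ hdg
    exact hd ⟨d, hne⟩ ((h.mem_D ⟨d, hne⟩).1 hdx) hdg

/-- Extension from the dag without the sink `g` commutes with the flips at all other vertices. -/
theorem Extends.flip_eq [Finite V] (hg : ∀ v, ¬ G.Adj g v) {x z : Tops l l'} {y : Tops m m'}
    (hx : Extends x y) {h : ({g}ᶜ : Set V)} (hz : Extends z (y.flip h)) : x.flip h.1 = z := by
  refine flip_eq_of_agree (fun v hv => ?_) fun v hv => ?_
  · by_cases hvg : v = g
    · subst hvg
      have hne : v ≠ h.1 := fun e => h.2 e.symm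
      simp only [hne, false_and, false_or, ne_eq, not_false_eq_true, and_true]
      rw [hx.self_mem_D_iff hg, hz.self_mem_D_iff hg]
      refine forall_congr' fun d => ?_
      by_cases hd : G.Adj d v
      · have hgt : ¬ (G.induce {v}ᶜ).Gt h d := fun e => hv (gt_trans (induce_gt e) (gt_of_adj hd))
        have hdh : d ≠ h := by rintro rfl; exact hv (gt_of_adj hd)
        simp [mem_flip_D_iff y hgt, hdh]
      · simp [hd]
    · have := mem_flip_D_iff y (g := h) (v := ⟨v, hvg⟩) fun e => hv (induce_gt e)
      rw [← hz.mem_D, ← hx.mem_D, ← hx.mem_U, Subtype.ext_iff, ne_eq, Subtype.ext_iff] at this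
      exact this
  · by_cases hvg : v = g
    · subst hvg
      have hne : v ≠ h.1 := fun e => h.2 e.symm
      simp [hne, hx.notMem, hz.notMem]
    · have := mem_flip_U_iff y (g := h) (v := ⟨v, hvg⟩) fun e => hv (induce_gt e)
      rw [← hz.mem_U, ← hx.mem_U, ← hx.mem_D, Subtype.ext_iff, ne_eq, Subtype.ext_iff] at this
      exact this

/-- If `g` is not an isolated vertex, then `g` is in the second component of less than half of the
tight orthogonal pairs: the flip at `g` moves `g` out of the second component, and its
image does not contain the pairs that avoid `g`. -/
theorem ncard_mem_U_lt [Finite V] {h : V} (hgh : G.undirected.Adj g h) :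
    {x : Tops l l' | g ∈ x.U}.ncard < {x : Tops l l' | g ∉ x.U}.ncard := by
  rw [← Set.ncard_image_of_injective _ (flipPerm l l' g).injective]
  refine Set.ncard_lt_ncard ⟨?_, fun hsub => ?_⟩ (Set.toFinite _)
  · rintro _ ⟨x, hx, rfl⟩ hx'
    exact (x.flip g).tight.orth.disj g (self_mem_flip_D.2 hx) hx'
  · obtain ⟨w, hw, hw'⟩ := exists_notMem (l := l) (l' := l') hgh
    obtain ⟨x, hx, rfl⟩ := hsub hw'
    exact hw (self_mem_flip_D.2 hx)

end Sink

/-! ### Connected dags -/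

/-- The group generated by the flips is primitive and contains the alternating group. -/
structure IsLarge {V : Type*} [Finite V] {G : Dag V} (l : G.LinearExt) (l' : G.DualLinearExt) :
    Prop where
  isPreprimitive :
    MulAction.IsPreprimitive (Subgroup.closure (Set.range (flipPerm l l'))) (Tops l l')
  alternatingGroup_le : alternatingGroup (Tops l l') ≤ Subgroup.closure (Set.range (flipPerm l l'))

section Connected

variable {V : Type*} [Finite V] {G : Dag V} {l : G.LinearExt} {l' : G.DualLinearExt}

theorem flipPerm_mem (g : V) : flipPerm l l' g ∈ Subgroup.closure (Set.range (flipPerm l l')) :=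
  Subgroup.subset_closure ⟨g, rfl⟩

theorem isLarge_of_subsingleton [Subsingleton V] [Nonempty V] : IsLarge l l' := by
  obtain ⟨v⟩ := ‹Nonempty V›
  have irr : ∀ a b, ¬ G.Adj a b := fun a b hab =>
    gt_irrefl a (gt_of_adj (Subsingleton.elim b a ▸ hab))
  have hflip : ∀ x : Tops l l', v ∈ (x.flip v).D ↔ v ∉ x.D := fun x => by
    rw [self_mem_flip_D, mem_U_iff]
    simp [irr]
  have : MulAction.IsPretransitive (Subgroup.closure (Set.range (flipPerm l l'))) (Tops l l') := by
    refine ⟨fun x y => ?_⟩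
    by_cases h : v ∈ x.D ↔ v ∈ y.D
    · exact ⟨1, eq_of_mem_D_iff (v := v) (by simpa using h)⟩
    · refine ⟨⟨_, flipPerm_mem v⟩, eq_of_mem_D_iff (v := v) ?_⟩
      rw [Subgroup.mk_smul, Equiv.Perm.smul_def, flipPerm_apply, hflip]
      tauto
  refine ⟨⟨fun {B} _ => MulAction.isTrivialBlock_of_card_le_two card_le_two B⟩, ?_⟩
  rw [alternatingGroup.eq_bot_of_card_le_two card_le_two]
  exact bot_le

/-- The flips of the reversed dag generate the same group, up to the identification of the tight
orthogonal pairs. -/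
theorem IsLarge.of_op (h : IsLarge l'.op l.op) : IsLarge l l' := by
  have lift := Equiv.Perm.lift_of_closure (f := (opEquiv l l').symm) (F := flipPerm l'.op l.op)
    (H := Subgroup.closure (Set.range (flipPerm l l'))) fun g => ⟨_, flipPerm_mem g, fun y => by
      obtain ⟨x, rfl⟩ := (opEquiv l l').surjective y
      rw [Equiv.symm_apply_apply, Equiv.eq_symm_apply]
      exact (op_flip g x).symm⟩
  have := h.isPreprimitive
  have htrans : MulAction.IsPretransitive (Subgroup.closure (Set.range (flipPerm l l')))
      (Tops l l') := by
    refine ⟨fun x y => ?_⟩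
    obtain ⟨σ, hσ⟩ := MulAction.exists_smul_eq (Subgroup.closure (Set.range (flipPerm l'.op l.op)))
      (opEquiv l l' x) (opEquiv l l' y)
    obtain ⟨k, hk, hk'⟩ := lift σ.1 σ.2
    refine ⟨⟨k, hk⟩, ?_⟩
    have := hk' (opEquiv l l' x)
    rw [Equiv.symm_apply_apply] at this
    rw [Subgroup.mk_smul, Equiv.Perm.smul_def, this, Equiv.symm_apply_eq]
    exact hσ
  have hcard : Nat.card (Tops l l') = Nat.card (Tops l'.op l.op) := Nat.card_congr (opEquiv l l')
  have hpos : 0 < Nat.card (Tops l l') := Nat.card_pos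
  refine ⟨Equiv.Perm.isPreprimitive_of_lift (opEquiv l l').symm.injective lift (by omega) htrans
    h.isPreprimitive, fun σ hσ => ?_⟩
  obtain ⟨k, hk, hk'⟩ := lift ((opEquiv l l').permCongr σ) (h.alternatingGroup_le (by
    rw [Equiv.Perm.mem_alternatingGroup] at hσ ⊢
    rw [Equiv.Perm.sign_permCongr, hσ]))
  have : k = σ := by
    ext1 x
    simpa using hk' (opEquiv l l' x)
  exact this ▸ hk

/-- The inductive step. Removal of the sink `g` leaves the set `{x | g ∉ x.U}`, which is more than
half of all tight orthogonal pairs. If there are at most four pairs without `g`, then the flip at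
an in-neighbor of `g` is a transposition. -/
theorem IsLarge.of_sink {g h : V} (hg : ∀ v, ¬ G.Adj g v) (hhg : G.Adj h g)
    (hconn : (G.induce {g}ᶜ).undirected.Connected) (m : (G.induce {g}ᶜ).LinearExt)
    (m' : (G.induce {g}ᶜ).DualLinearExt) (ih : IsLarge m m') : IsLarge l l' := by
  have hadj : G.undirected.Adj g h := undirected_adj.2 (Or.inr hhg)
  choose f hf using exists_extends (m := m) (m' := m') l l' hg
  have hinj : Function.Injective f := fun y z hyz => (hf y).unique (hyz ▸ hf z)
  have hflip : ∀ (v : ({g}ᶜ : Set V)) y, (f y).flip v.1 = f (y.flip v) := fun v y =>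
    (hf y).flip_eq hg (hf _)
  have hrange : Set.range f = {x : Tops l l' | g ∉ x.U} := by
    refine Set.Subset.antisymm (Set.range_subset_iff.2 fun y => (hf y).notMem) fun x hx => ?_
    obtain ⟨y, hy⟩ := exists_extended m m' hg hx
    refine ⟨y, eq_of_agree (g := g) (fun v hv => ?_) fun v hv => ?_⟩
    · by_cases hvg : v = g
      · subst hvg
        rw [(hf y).self_mem_D_iff hg, hy.self_mem_D_iff hg]
      · exact ((hf y).mem_D ⟨v, hvg⟩).trans (hy.mem_D ⟨v, hvg⟩).symm
    · by_cases hvg : v = g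
      · subst hvg
        exact iff_of_false (hf y).notMem hx
      · exact ((hf y).mem_U ⟨v, hvg⟩).trans (hy.mem_U ⟨v, hvg⟩).symm
  have hcardY : {x : Tops l l' | g ∉ x.U}.ncard = Nat.card (Tops m m') := by
    rw [← hrange]
    exact Set.ncard_range_of_injective hinj
  have hcard : Nat.card (Tops l l') < 2 * Nat.card (Tops m m') := by
    have h1 := ncard_mem_U_lt (l := l) (l' := l') hadj
    have h2 := Set.ncard_add_ncard_compl {x : Tops l l' | g ∈ x.U}
    have h3 : {x : Tops l l' | g ∈ x.U}ᶜ = {x : Tops l l' | g ∉ x.U} := rfl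
    rw [h3] at h2
    omega
  set H := Subgroup.closure (Set.range (flipPerm l l')) with hH
  have lift := Equiv.Perm.lift_of_closure (f := f) (F := flipPerm m m') (H := H)
    fun v => ⟨_, flipPerm_mem v.1, hflip v⟩
  have htrans : MulAction.IsPretransitive H (Tops l l') := by
    have := ih.isPreprimitive
    have toY : ∀ x : Tops l l', ∃ k ∈ H, ∃ y, k x = f y := fun x => by
      by_cases hx : g ∈ x.U
      · have : x.flip g ∈ Set.range f := by
          rw [hrange]
          exact (x.flip g).tight.orth.disj g (self_mem_flip_D.2 hx)
        obtain ⟨y, hy⟩ := this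
        exact ⟨_, flipPerm_mem g, y, hy.symm⟩
      · have : x ∈ Set.range f := by rwa [hrange]
        obtain ⟨y, hy⟩ := this
        exact ⟨1, one_mem _, y, hy.symm⟩
    refine ⟨fun x z => ?_⟩
    obtain ⟨k, hk, y, hy⟩ := toY x
    obtain ⟨n, hn, w, hw⟩ := toY z
    obtain ⟨σ, hσ⟩ := MulAction.exists_smul_eq (Subgroup.closure (Set.range (flipPerm m m'))) y w
    obtain ⟨p, hp, hp'⟩ := lift σ.1 σ.2
    refine ⟨⟨n⁻¹ * (p * k), mul_mem (inv_mem hn) (mul_mem hp hk)⟩, ?_⟩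
    have hσ' : σ.1 y = w := hσ
    rw [Subgroup.mk_smul, Equiv.Perm.smul_def, Equiv.Perm.mul_apply, Equiv.Perm.mul_apply, hy, hp',
      hσ', ← hw]
    simp
  have hprim : MulAction.IsPreprimitive H (Tops l l') :=
    Equiv.Perm.isPreprimitive_of_lift hinj lift hcard htrans ih.isPreprimitive
  refine ⟨hprim, ?_⟩
  by_cases h5 : 5 ≤ Nat.card (Tops m m')
  · exact Equiv.Perm.alternatingGroup_le_of_lift ⟨f, hinj⟩
      (fun σ hσ => lift σ (ih.alternatingGroup_le hσ)) h5 hcard hprim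
  suffices h3 : Set.ncard {x | flipPerm l l' h x ≠ x} ≤ 3 by
    rw [← hH, Equiv.Perm.eq_top_of_involutive_mem hprim (flipPerm_mem h) (flip_flip h)
      (flipPerm_ne_one h) h3]
    exact le_top
  -- An edge from `h` to `g` keeps `h` out of both components if `g` is in the second one.
  have hsub : {x | flipPerm l l' h x ≠ x} ⊆ {x : Tops l l' | g ∉ x.U} := fun x hx hgx => by
    refine hx (flip_of_not ?_)
    rintro (hh | hh)
    · exact x.tight.orth.noEdge h hh g hgx hhg
    · exact x.tight.orth.indepU h hh g hgx hhg
  have hne : h ≠ g := hadj.ne'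
  let h' : ({g}ᶜ : Set V) := ⟨h, hne⟩
  rcases subsingleton_or_nontrivial ({g}ᶜ : Set V) with hs | hs
  · have : Nonempty ({g}ᶜ : Set V) := ⟨h'⟩
    have h2 : Nat.card (Tops m m') ≤ 2 := card_le_two
    exact (Set.ncard_le_ncard hsub).trans (by omega)
  · obtain ⟨k, hk⟩ := hconn.preconnected.exists_adj_of_nontrivial h'
    obtain ⟨y, hy⟩ := exists_notMem (l := m) (l' := m') hk
    have hlt : {x | flipPerm l l' h x ≠ x}.ncard < {x : Tops l l' | g ∉ x.U}.ncard := by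
      refine Set.ncard_lt_ncard ⟨hsub, fun hsub' => hsub' (hf y).notMem ?_⟩ (Set.toFinite _)
      have := hflip h' y
      rwa [flip_of_not (x := y) (by tauto)] at this
    omega

end Connected

/-- The flips of a connected dag generate a primitive group that contains the alternating group. -/
theorem isLarge_of_connected {V : Type*} [Finite V] {G : Dag V} (l : G.LinearExt)
    (l' : G.DualLinearExt) (hG : G.undirected.Connected) : IsLarge l l' := by
  induction hn : Nat.card V using Nat.strong_induction_on generalizing V with
  | _ n ih =>
    have := hG.nonempty
    rcases subsingleton_or_nontrivial V with hs | hs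
    · exact isLarge_of_subsingleton
    have step : ∀ (G : Dag V) (l : G.LinearExt) (l' : G.DualLinearExt) (g : V),
        G.undirected.Connected → (∀ v, ¬ G.Adj g v) → (G.induce {g}ᶜ).undirected.Connected →
        IsLarge l l' := by
      intro G l l' g hG hg hconn
      obtain ⟨h, hgh⟩ := hG.preconnected.exists_adj_of_nontrivial g
      have hhg := (undirected_adj.1 hgh).resolve_left (hg h)
      obtain ⟨m⟩ := l.nonempty_induce {g}ᶜ
      obtain ⟨m'⟩ := l'.nonempty_induce {g}ᶜ
      refine IsLarge.of_sink hg hhg hconn m m' (ih _ ?_ m m' hconn rfl)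
      rw [← hn]
      exact Finite.card_subtype_lt (x := g) (by simp)
    obtain ⟨g, hg | hg, hconn⟩ := exists_extremal_connected hG
    · exact step G l l' g hG hg hconn
    · refine IsLarge.of_op (step G.op l'.op l.op g ?_ hg ?_)
      · rwa [op_undirected]
      · rwa [induce_undirected, op_undirected, ← induce_undirected]

end Tops

end Dag

/-! ### Permutation groups acting on the factors of a product -/

namespace Equiv.Perm

/-- If every generator of a permutation group of a product acts on one factor only, and is one of
the given generators of a permutation group of that factor, then the group is the direct product of
the groups acting on the factors. -/
theorem exists_mulEquiv_pi {I X C : Type*} [Finite I] [DecidableEq I] {T J : I → Type*}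
    [∀ i, Nonempty (T i)] (e : X ≃ ∀ i, T i) (F : C → Perm X) (E : ∀ i, J i → Perm (T i))
    (inc : ∀ i, J i → C) (hinc : ∀ c, ∃ i j, inc i j = c)
    (h : ∀ i j x, e (F (inc i j) x) = Function.update (e x) i (E i j (e x i))) :
    ∃ φ : Subgroup.closure (Set.range F) ≃* (∀ i, Subgroup.closure (Set.range (E i))),
      ∀ i j, φ ⟨F (inc i j), Subgroup.subset_closure ⟨_, rfl⟩⟩ =
        Pi.mulSingle i ⟨E i j, Subgroup.subset_closure ⟨_, rfl⟩⟩ := by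
  let Ψ : (∀ i, Subgroup.closure (Set.range (E i))) →* Perm X :=
    { toFun σ := e.symm.permCongr (Equiv.piCongrRight fun i => (σ i).1)
      map_one' := by ext x; simp [Equiv.piCongrRight]
      map_mul' σ τ := by ext x; simp [Equiv.piCongrRight]; rfl }
  have hΨ : ∀ σ x i, e (Ψ σ x) i = (σ i).1 (e x i) := fun σ x i => by
    simp [Ψ, Equiv.piCongrRight]
  have hinj : Function.Injective Ψ := fun σ τ hστ => by
    ext i t
    obtain ⟨y⟩ : Nonempty (∀ i, T i) := inferInstance
    have := hΨ σ (e.symm (Function.update y i t)) i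
    rw [hστ, hΨ] at this
    simpa using this.symm
  have hgen : ∀ i j,
      Ψ (Pi.mulSingle i ⟨E i j, Subgroup.subset_closure ⟨_, rfl⟩⟩) = F (inc i j) := fun i j => by
    ext1 x
    apply e.injective
    funext k
    rw [hΨ, h]
    by_cases hk : k = i
    · subst hk
      simp
    · simp [hk]
  have hle : ∀ σ, Ψ σ ∈ Subgroup.closure (Set.range F) := by
    intro σ
    have hpi := Subgroup.pi_le_iff (H := fun i => (⊤ : Subgroup (Subgroup.closure
      (Set.range (E i))))) (J := (Subgroup.closure (Set.range F)).comap Ψ)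
    refine hpi.2 (fun i => ?_) (Subgroup.mem_pi _ |>.2 fun i _ => Subgroup.mem_top (σ i))
    rw [Subgroup.map_le_iff_le_comap, ← Subgroup.closure_closure_coe_preimage,
      Subgroup.closure_le]
    rintro ⟨_, _⟩ ⟨j, rfl⟩
    exact Subgroup.subset_closure ⟨inc i j, (hgen i j).symm⟩
  have hge : Subgroup.closure (Set.range F) ≤ Ψ.range := by
    rw [Subgroup.closure_le]
    rintro _ ⟨c, rfl⟩
    obtain ⟨i, j, rfl⟩ := hinc c
    exact ⟨_, hgen i j⟩
  have hbij : Function.Bijective (Ψ.codRestrict (Subgroup.closure (Set.range F)) hle) := by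
    refine ⟨fun σ τ hστ => hinj (congrArg Subtype.val hστ), fun ⟨τ, hτ⟩ => ?_⟩
    obtain ⟨σ, rfl⟩ := hge hτ
    exact ⟨σ, rfl⟩
  refine ⟨(MulEquiv.ofBijective _ hbij).symm, fun i j => ?_⟩
  rw [MulEquiv.symm_apply_eq]
  exact Subtype.ext (hgen i j).symm

end Equiv.Perm

/-! ### Connected components -/

namespace Dag

section Component

variable {V : Type*} {G : Dag V} {c : G.undirected.ConnectedComponent}

theorem mem_supp_congr {a b : V} (h : G.Adj a b) : a ∈ c.supp ↔ b ∈ c.supp :=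
  c.mem_supp_congr_adj (undirected_adj.2 (Or.inl h))

theorem mem_supp_congr_gt {a b : V} (h : G.Gt a b) : a ∈ c.supp ↔ b ∈ c.supp := by
  induction h with
  | single h => exact mem_supp_congr h
  | tail _ h ih => exact ih.trans (mem_supp_congr h)

theorem component_gt {a b : c.supp} : (G.component c).Gt a b ↔ G.Gt a b := by
  refine ⟨induce_gt, fun h => ?_⟩
  obtain ⟨b, hb⟩ := b
  change G.Gt a.1 b at h
  induction h with
  | single h => exact gt_of_adj (show G.Adj a.1 _ from h)
  | tail h h' ih =>
    have hb' := (mem_supp_congr h').2 hb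
    exact gt_trans (ih hb') (gt_of_adj (show G.Adj _ _ from h'))

end Component

namespace Tops

variable {V : Type*} {G : Dag V} {l : G.LinearExt} {l' : G.DualLinearExt}
  {m : ∀ c : G.undirected.ConnectedComponent, (G.component c).LinearExt}
  {m' : ∀ c : G.undirected.ConnectedComponent, (G.component c).DualLinearExt}

open scoped Classical in
/-- The restriction of a tight orthogonal pair to a connected component. -/
noncomputable def restrict (c : G.undirected.ConnectedComponent) (n : (G.component c).LinearExt)
    (n' : (G.component c).DualLinearExt) (x : Tops l l') : Tops n n' where
  D := x.D.subtype (· ∈ c.supp)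
  U := x.U.subtype (· ∈ c.supp)
  tight := by
    obtain ⟨ho, ht⟩ := tight_iff.1 x.tight
    refine tight_iff.2 ⟨⟨fun a ha b hb => ?_, fun a ha b hb => ?_, fun v hv hv' => ?_,
      fun d hd u hu => ?_⟩, fun v hv hv' => ?_⟩
    · exact ho.indepD _ (Finset.mem_subtype.1 ha) _ (Finset.mem_subtype.1 hb)
    · exact ho.indepU _ (Finset.mem_subtype.1 ha) _ (Finset.mem_subtype.1 hb)
    · exact ho.disj _ (Finset.mem_subtype.1 hv) (Finset.mem_subtype.1 hv')
    · exact ho.noEdge _ (Finset.mem_subtype.1 hd) _ (Finset.mem_subtype.1 hu)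
    · rw [Finset.mem_subtype] at hv hv'
      rcases ht v hv hv' with ⟨d, hd, hdv⟩ | ⟨u, hu, hvu⟩
      · exact Or.inl ⟨⟨d, (mem_supp_congr hdv).2 v.2⟩, Finset.mem_subtype.2 hd, hdv⟩
      · exact Or.inr ⟨⟨u, (mem_supp_congr hvu).1 v.2⟩, Finset.mem_subtype.2 hu, hvu⟩

section Restrict

variable {c : G.undirected.ConnectedComponent} {n : (G.component c).LinearExt}
    {n' : (G.component c).DualLinearExt}

theorem mem_restrict_D {x : Tops l l'} {v : c.supp} : v ∈ (x.restrict c n n').D ↔ v.1 ∈ x.D := by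
  simp [restrict]

theorem mem_restrict_U {x : Tops l l'} {v : c.supp} : v ∈ (x.restrict c n n').U ↔ v.1 ∈ x.U := by
  simp [restrict]

theorem restrict_flip [Finite V] (x : Tops l l') (v : c.supp) :
    (x.flip v.1).restrict c n n' = (x.restrict c n n').flip v := by
  refine (flip_eq_of_agree (fun w hw => ?_) fun w hw => ?_).symm
  · rw [component_gt] at hw
    rw [mem_restrict_D, mem_restrict_D, mem_restrict_U, mem_flip_D_iff x hw, ne_eq, ne_eq,
      Subtype.ext_iff]
  · rw [component_gt] at hw
    rw [mem_restrict_U, mem_restrict_D, mem_restrict_U, mem_flip_U_iff x hw, ne_eq, ne_eq,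
      Subtype.ext_iff]

theorem restrict_flip_of_notMem (x : Tops l l') {v : V} (hv : v ∉ c.supp) :
    (x.flip v).restrict c n n' = x.restrict c n n' := by
  have hne : ∀ w : c.supp, w.1 ≠ v := by
    rintro w rfl
    exact hv w.2
  refine Tops.ext (Finset.ext fun w => ?_) (Finset.ext fun w => ?_)
  · rw [mem_restrict_D, mem_restrict_D,
      mem_flip_D_iff x fun h => hv ((mem_supp_congr_gt h).2 w.2)]
    simp [hne w]
  · rw [mem_restrict_U, mem_restrict_U,
      mem_flip_U_iff x fun h => hv ((mem_supp_congr_gt h).1 w.2)]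
    simp [hne w]

end Restrict

/-- Tight orthogonal pairs are given by tight orthogonal pairs of the connected components. -/
theorem bijective_restrict [Finite V] : Function.Bijective
    fun (x : Tops l l') (c : G.undirected.ConnectedComponent) => x.restrict c (m c) (m' c) := by
  classical
  constructor
  · intro x y hxy
    refine Tops.ext (Finset.ext fun v => ?_) (Finset.ext fun v => ?_)
    all_goals
      have h : x.restrict _ (m _) (m' _) = y.restrict _ (m _) (m' _) :=
        congrFun hxy (G.undirected.connectedComponentMk v)
    · rw [← mem_restrict_D (v := ⟨v, rfl⟩), h, mem_restrict_D]
    · rw [← mem_restrict_U (v := ⟨v, rfl⟩), h, mem_restrict_U]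
  · intro y
    have := Fintype.ofFinite V
    let D : Finset V := {v | (⟨v, rfl⟩ : (G.undirected.connectedComponentMk v).supp) ∈ (y _).D}
    let U : Finset V := {v | (⟨v, rfl⟩ : (G.undirected.connectedComponentMk v).supp) ∈ (y _).U}
    have hD : ∀ c (v : V) (hv : v ∈ c.supp), v ∈ D ↔ (⟨v, hv⟩ : c.supp) ∈ (y c).D := by
      rintro _ v rfl
      simp [D]
    have hU : ∀ c (v : V) (hv : v ∈ c.supp), v ∈ U ↔ (⟨v, hv⟩ : c.supp) ∈ (y c).U := by
      rintro _ v rfl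
      simp [U]
    have htight : G.Tight D U := by
      refine tight_iff.2 ⟨⟨fun a ha b hb hab => ?_, fun a ha b hb hab => ?_, fun v hv hv' => ?_,
        fun d hd u hu hdu => ?_⟩, fun v hv hv' => ?_⟩
      · have hb' := (mem_supp_congr hab).1 (rfl : a ∈ (G.undirected.connectedComponentMk a).supp)
        exact (y _).tight.orth.indepD _ ((hD _ a rfl).1 ha) _ ((hD _ b hb').1 hb) hab
      · have hb' := (mem_supp_congr hab).1 (rfl : a ∈ (G.undirected.connectedComponentMk a).supp)
        exact (y _).tight.orth.indepU _ ((hU _ a rfl).1 ha) _ ((hU _ b hb').1 hb) hab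
      · exact (y _).tight.orth.disj _ ((hD _ v rfl).1 hv) ((hU _ v rfl).1 hv')
      · have hu' := (mem_supp_congr hdu).1 (rfl : d ∈ (G.undirected.connectedComponentMk d).supp)
        exact (y _).tight.orth.noEdge _ ((hD _ d rfl).1 hd) _ ((hU _ u hu').1 hu) hdu
      · rw [hD _ v rfl] at hv
        rw [hU _ v rfl] at hv'
        rcases (tight_iff.1 (y _).tight).2 _ hv hv' with ⟨d, hd, hdv⟩ | ⟨u, hu, hvu⟩
        · exact Or.inl ⟨d, (hD _ d d.2).2 hd, hdv⟩
        · exact Or.inr ⟨u, (hU _ u u.2).2 hu, hvu⟩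
    refine ⟨⟨D, U, htight⟩, ?_⟩
    funext c
    refine Tops.ext (Finset.ext fun v => ?_) (Finset.ext fun v => ?_)
    · exact mem_restrict_D.trans (hD c v v.2)
    · exact mem_restrict_U.trans (hU c v v.2)

end Tops

end Dag

theorem mainTheorem2 {V : Type*} [Finite V] (G : Dag V) (l : G.LinearExt) (l' : G.DualLinearExt) :
    (G.undirected.Connected →
      alternatingGroup (Dag.Tops l l') ≤ (Dag.Tops.flipColoring l l').coloringGroup) ∧
    (¬ G.undirected.Connected →
      ∀ (m : ∀ c : G.undirected.ConnectedComponent, (G.component c).LinearExt)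
        (m' : ∀ c : G.undirected.ConnectedComponent, (G.component c).DualLinearExt),
      ∃ φ : (Dag.Tops.flipColoring l l').coloringGroup ≃*
          ((c : G.undirected.ConnectedComponent) →
            (Dag.Tops.flipColoring (m c) (m' c)).coloringGroup),
        ∀ (c : G.undirected.ConnectedComponent) (v : c.supp),
          φ ((Dag.Tops.flipColoring l l').gen v) c =
              (Dag.Tops.flipColoring (m c) (m' c)).gen v ∧
            ∀ c' ≠ c, φ ((Dag.Tops.flipColoring l l').gen v) c' = 1) := by
  refine ⟨fun hG => ?_, fun _ m m' => ?_⟩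
  · rw [Dag.Tops.coloringGroup_eq]
    exact (Dag.Tops.isLarge_of_connected l l' hG).alternatingGroup_le
  · classical
    obtain ⟨φ, hφ⟩ := Equiv.Perm.exists_mulEquiv_pi
      (Equiv.ofBijective _ (Dag.Tops.bijective_restrict (l := l) (l' := l') (m := m) (m' := m')))
      (Dag.Tops.flipColoring l l').tau (fun c => (Dag.Tops.flipColoring (m c) (m' c)).tau)
      (fun c v => v.1) (fun v => ⟨G.undirected.connectedComponentMk v, ⟨v, rfl⟩, rfl⟩) (by
        intro c v x
        funext c'
        rw [Dag.Tops.tau_eq_flipPerm, Dag.Tops.tau_eq_flipPerm]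
        by_cases hc : c' = c
        · subst hc
          simpa using Dag.Tops.restrict_flip x v
        · rw [Function.update_of_ne hc]
          exact Dag.Tops.restrict_flip_of_notMem x fun hv => hc (hv.symm.trans v.2))
    refine ⟨φ, fun c v => ⟨?_, fun c' hc => ?_⟩⟩
    · exact (congrFun (hφ c v) c).trans (Pi.mulSingle_eq_same _ _)
    · exact (congrFun (hφ c v) c').trans (Pi.mulSingle_eq_of_ne hc _)
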